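/- Let $d\ge 2$ be an integer, let $\mathbb S^d=\{x\in\mathbb R^{d+1}:|x|=1\}$ be the round unit sphere with surface measure $|\mathbb S^d|$, and let $\lambda_1\le\lambda_2\le\cdots$ be the eigenvalues of $-\Delta$ on $\mathbb S^d$ ($\Delta$ the Laplace–Beltrami operator), repeated according to multiplicity. Let $$R_1(z)=\sum_j (z-\lambda_j)_+$$ be the first Riesz mean, let $L^{class}_{1,d}=(4\pi)^{-d/2}\,\Gamma(2)/\Gamma(2+d/2)$, let $\psi(\eta)=\eta-\lfloor\eta\rfloor-\tfrac12$ for $\eta\ge 0$, and for $z\ge 0$ let $w=w(z)\ge 0$ be defined by $w(w+d-1)=z$. Put $$c_d(w)=\frac{d(d+2)}{12}\Big(d-2+6\big(\tfrac14-\psi(w)^2\big)\Big).$$ Then $R_1(z)$ is finite for every real $z$, and as $z\to+\infty$ $$\frac{R_1(z)}{L^{class}_{1,d}\,|\mathbb S^d|\,z^{\frac d2+1}}=1+c_d(w)\,z^{-1}+o(z^{-1}).$$ In particular there is no term of order $z^{-1/2}$: the left-hand side is $1+o(z^{-1/2})$. Moreover, for all $z\ge0$, $$\frac{d(d+2)(d-2)}{12}\le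 c_d(w(z))\le\frac{d(d+2)(2d-1)}{24},$$ and each of the two bounds is attained for arbitrarily large $z$, so that the coefficient oscillates. The coefficient $c_d(w(z))$ is nonnegative for all $z\ge 0$, and it vanishes if and only if $d=2$ and $w(z)$ is an integer; in particular it is positive for all $d\ge3$. -/

import Mathlib

open Metric Set Filter MeasureTheory
open scoped Manifold ContDiff Topology Asymptotics Laplacian

noncomputable section

namespace RieszSphere

/-- The Euclidean space `ℝ^{d+1}`. -/
abbrev Ambient (d : ℕ) : Type := EuclideanSpace ℝ (Fin (d + 1))

/-- The round unit sphere `𝕊^d ⊆ ℝ^{d+1}`. -/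
abbrev Sphere (d : ℕ) : Type := sphere (0 : Ambient d) 1

/-- Smooth real-valued functions on `𝕊^d`, for the standard smooth structure of the sphere. -/
abbrev SmoothFun (d : ℕ) : Type := C^∞⟮𝓡 d, Sphere d; 𝓘(ℝ), ℝ⟯

theorem normalize_mem {d : ℕ} {y : Ambient d} (hy : y ≠ 0) :
    ‖y‖⁻¹ • y ∈ sphere (0 : Ambient d) 1 := by
  simp [norm_smul, hy]

open Classical in
/-- The positively homogeneous extension of degree `0` of a function on the sphere,
`y ↦ u (y / |y|)` for `y ≠ 0` (with the irrelevant value `0` at the origin). -/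
def homExtension {d : ℕ} (u : Sphere d → ℝ) (y : Ambient d) : ℝ :=
  if hy : y ≠ 0 then u ⟨‖y‖⁻¹ • y, normalize_mem hy⟩ else 0

/-- The Laplacian (Laplace-Beltrami operator) of the round sphere: the Euclidean Laplacian of the
homogeneous extension of degree `0`, restricted to the sphere. -/
def sphereLaplacian {d : ℕ} (u : Sphere d → ℝ) (x : Sphere d) : ℝ :=
  (Δ (homExtension u)) (x : Ambient d)

/-- The homogeneous extension of a smooth function is smooth at the points of the sphere. -/
theorem contDiffAt_homExtension {d : ℕ} (u : SmoothFun d) (x : Sphere d) :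
    ContDiffAt ℝ ∞ (homExtension u) (x : Ambient d) := by
  have : Fact (Module.finrank ℝ (Ambient d) = d + 1) := ⟨by simp⟩
  let U : TopologicalSpace.Opens (Ambient d) := ⟨{0}ᶜ, isOpen_compl_singleton⟩
  have hx : (x : Ambient d) ∈ U := by
    intro h
    have h1 : ‖(x : Ambient d)‖ = 1 := by simp
    rw [mem_singleton_iff.mp h] at h1
    simp at h1
  let f : U → Ambient d := fun y => ‖(y : Ambient d)‖⁻¹ • (y : Ambient d)
  have hf : ContMDiff 𝓘(ℝ, Ambient d) 𝓘(ℝ, Ambient d) ∞ f := by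
    intro y
    have h0 : (y : Ambient d) ≠ 0 := y.2
    have : ContMDiffAt 𝓘(ℝ, Ambient d) 𝓘(ℝ, Ambient d) ∞
        (fun y : Ambient d => ‖y‖⁻¹ • y) (y : Ambient d) :=
      (((contDiffAt_norm ℝ h0).inv (norm_ne_zero_iff.mpr h0)).smul contDiffAt_id).contMDiffAt
    exact (contMDiffAt_subtype_iff (U := U)).mpr this
  have hmem : ∀ y : U, f y ∈ sphere (0 : Ambient d) 1 := fun y => normalize_mem y.2
  have hg := hf.codRestrict_sphere (n := d) hmem
  have hug := u.contMDiff.comp hg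
  have key := hug ⟨x, hx⟩
  have heq : (u ∘ Set.codRestrict f _ hmem) = fun y : U => homExtension u (y : Ambient d) := by
    funext y
    have h0 : (y : Ambient d) ≠ 0 := y.2
    simp only [homExtension, dif_pos h0, Function.comp]
    rfl
  rw [heq] at key
  exact ((contMDiffAt_subtype_iff (U := U) (x := ⟨x, hx⟩)).mp key).contDiffAt

theorem two_le_smooth : (2 : ℕ∞ω) ≤ ∞ :=
  WithTop.coe_le_coe.mpr (le_top : (2 : ℕ∞) ≤ ⊤)

theorem sphereLaplacian_add {d : ℕ} (u v : SmoothFun d) (x : Sphere d) :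
    sphereLaplacian (u + v : SmoothFun d) x = sphereLaplacian u x + sphereLaplacian v x := by
  have h : homExtension (u + v : SmoothFun d) = homExtension u + homExtension v := by
    funext y
    by_cases hy : y ≠ 0 <;> simp [homExtension, hy]
  unfold sphereLaplacian
  rw [h]
  exact ((contDiffAt_homExtension u x).of_le two_le_smooth).laplacian_add
    ((contDiffAt_homExtension v x).of_le two_le_smooth)

theorem sphereLaplacian_smul {d : ℕ} (c : ℝ) (u : SmoothFun d) (x : Sphere d) :
    sphereLaplacian (c • u : SmoothFun d) x = c * sphereLaplacian u x := by
  have h : homExtension (c • u : SmoothFun d) = c • homExtension u := by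
    funext y
    by_cases hy : y ≠ 0 <;> simp [homExtension, hy]
  unfold sphereLaplacian
  rw [h]
  exact InnerProductSpace.laplacian_smul c
    ((contDiffAt_homExtension u x).of_le two_le_smooth)

/-- The space of all smooth `u` on `𝕊^d` with `-Δ u = μ u`. -/
def eigenspace (d : ℕ) (μ : ℝ) : Submodule ℝ (SmoothFun d) where
  carrier := {u | ∀ x, -sphereLaplacian u x = μ * u x}
  zero_mem' := by
    intro x
    have h := sphereLaplacian_smul (0 : ℝ) (0 : SmoothFun d) x
    rw [zero_smul, zero_mul] at h
    rw [h]
    simp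
  add_mem' := by
    intro u v hu hv x
    have := hu x
    have := hv x
    rw [sphereLaplacian_add, ContMDiffMap.coe_add, Pi.add_apply]
    linarith
  smul_mem' := by
    intro c u hu x
    have := hu x
    rw [sphereLaplacian_smul, ContMDiffMap.coe_smul, Pi.smul_apply, smul_eq_mul]
    linear_combination c * this

/-- The multiplicity of `μ` as an eigenvalue of `-Δ` on `𝕊^d` (`0` if it is not an eigenvalue,
`∞` if the eigenspace has infinite dimension). -/
def multiplicity (d : ℕ) (μ : ℝ) : ℕ∞ :=
  Cardinal.toENat (Module.rank ℝ (eigenspace d μ))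

/-- The first Riesz mean `R₁(z) = ∑_j (z - λ_j)_+` of the Laplacian on `𝕊^d`, where the `λ_j` are
the eigenvalues of `-Δ` counted with multiplicity. It is an unconditional sum in `[0, ∞]`. -/
def rieszMean (d : ℕ) (z : ℝ) : ENNReal :=
  ∑' μ : ℝ, (multiplicity d μ : ENNReal) * ENNReal.ofReal (z - μ)

/-- The semiclassical constant `L^{class}_{γ,d}`. -/
def semiclassicalConst (γ : ℝ) (d : ℕ) : ℝ :=
  (4 * Real.pi) ^ (-(d : ℝ) / 2) * (Real.Gamma (γ + 1) / Real.Gamma (γ + 1 + (d : ℝ) / 2))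

/-- The surface measure `|𝕊^d|` of the unit sphere. -/
def sphereArea (d : ℕ) : ℝ :=
  (volume : Measure (Ambient d)).toSphere.real univ

/-- The fluctuation function `ψ(η) = η - ⌊η⌋ - 1/2`. -/
def fluct (η : ℝ) : ℝ := η - (⌊η⌋ : ℝ) - 1 / 2

/-- The ratio `R₁(z) / (L^{class}_{1,d} |𝕊^d| z^{d/2+1})`. -/
def rieszRatio (d : ℕ) (z : ℝ) : ℝ :=
  (rieszMean d z).toReal / (semiclassicalConst 1 d * sphereArea d * z ^ ((d : ℝ) / 2 + 1))

/-- The coefficient `(d(d+2)/12) (d - 2 + 6 (1/4 - ψ(w)²))` of `z⁻¹`. -/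
def secondCoeff (d : ℕ) (w : ℝ) : ℝ :=
  (d : ℝ) * (d + 2) / 12 * ((d : ℝ) - 2 + 6 * (1 / 4 - fluct w ^ 2))

end RieszSphere

end

/-!
The spectrum of the sphere is determined first. Functions on the sphere are studied through their
extensions to `ℝ^{d+1}` that are homogeneous of degree `0`.

* A harmonic homogeneous polynomial `p` of degree `k` restricts to an eigenfunction for
  `k (k + d - 1)`, because its extension is `p |y|^{-k}` (`sphereRestrict_mem_eigenspace`). On
  homogeneous polynomials of a fixed degree the operator `q ↦ Δ (|x|² q)` is bijective, so `Δ` is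
  onto and each homogeneous polynomial is a harmonic one plus a multiple of `|x|²`. This gives the
  dimensions of the spaces of spherical harmonics (`finrank_harmonicPoly_add`), and shows that
  spherical harmonics span all polynomial functions on the sphere.
* There are no other eigenfunctions. Green's identity in a spherical shell, with a radial cutoff
  whose gradient is orthogonal to the tangential gradients of the extensions (`integral_green`),
  makes eigenfunctions for different eigenvalues orthogonal for the weighted integral `shellInner`
  over the shell, with no integration on the sphere itself. A function orthogonal to all spherical
  harmonics is orthogonal to all polynomials, hence zero by the Stone-Weierstrass theorem
  (`eq_zero_of_shellInner_harmonicPoly`). So pairing with harmonic polynomials is injective on each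
  eigenspace, which bounds its dimension from above (`multiplicity_sphereEigenvalue`,
  `multiplicity_eq_zero`).

The sum over eigenvalues telescopes: with `n = ⌊w⌋` and `N(n)` the number of eigenvalues
`k (k + d - 1)` with `k ≤ n`, `R₁(z) = N(n) (z - d n (n + d) / (d + 2))` (`sum_finrank_mul_sub`,
`rieszMean_toReal`). By the duplication formula the normalising constant is `4 / ((d + 2) d!)`.

In terms of `W = w + (d - 1) / 2` one has `z = W² - (d - 1)² / 4` and `n + d / 2 = W - ψ(w)`, so
that the ratio is a product of factors `1 + O(1 / W)` with bounded coefficients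
(`rieszRatio_eq`). In the product of their second-order expansions the terms in `1 / W` cancel, and
the coefficient of `1 / W²` is the stated one (`rieszRatio_isLittleO_shift`). The bounds on that
coefficient and its zeros come from `0 ≤ ψ² ≤ 1 / 4`, with `ψ² = 1 / 4` exactly at the integers and
`ψ = 0` at the half-integers.
-/

noncomputable section

namespace RieszSphere

variable {d : ℕ}

/-! ### Partial derivatives and the Euclidean Laplacian -/

/-- The partial derivative `∂ᵢ f` of a function on `ℝ^{d+1}`. -/
def partialDeriv {d : ℕ} (i : Fin (d + 1)) (f : Ambient d → ℝ) (y : Ambient d) : ℝ :=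
  fderiv ℝ f y (EuclideanSpace.single i 1)


theorem _root_.HasFDerivAt.partialDeriv_eq {i : Fin (d + 1)} {f : Ambient d → ℝ}
    {f' : Ambient d →L[ℝ] ℝ} {y : Ambient d} (h : HasFDerivAt f f' y) :
    partialDeriv i f y = f' (EuclideanSpace.single i 1) := by
  rw [partialDeriv, h.fderiv]

theorem partialDeriv_congr {i : Fin (d + 1)} {f g : Ambient d → ℝ} {y : Ambient d}
    (h : f =ᶠ[𝓝 y] g) : partialDeriv i f y = partialDeriv i g y := by
  rw [partialDeriv, partialDeriv, h.fderiv_eq]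

theorem partialDeriv_add {i : Fin (d + 1)} {f g : Ambient d → ℝ} {y : Ambient d}
    (hf : DifferentiableAt ℝ f y) (hg : DifferentiableAt ℝ g y) :
    partialDeriv i (fun z => f z + g z) y = partialDeriv i f y + partialDeriv i g y := by
  rw [(hf.hasFDerivAt.fun_add hg.hasFDerivAt).partialDeriv_eq]
  rfl

theorem partialDeriv_sub {i : Fin (d + 1)} {f g : Ambient d → ℝ} {y : Ambient d}
    (hf : DifferentiableAt ℝ f y) (hg : DifferentiableAt ℝ g y) :
    partialDeriv i (fun z => f z - g z) y = partialDeriv i f y - partialDeriv i g y := by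
  rw [(hf.hasFDerivAt.fun_sub hg.hasFDerivAt).partialDeriv_eq]
  rfl

theorem partialDeriv_mul {i : Fin (d + 1)} {f g : Ambient d → ℝ} {y : Ambient d}
    (hf : DifferentiableAt ℝ f y) (hg : DifferentiableAt ℝ g y) :
    partialDeriv i (fun z => f z * g z) y =
      f y * partialDeriv i g y + g y * partialDeriv i f y := by
  rw [(hf.hasFDerivAt.fun_mul hg.hasFDerivAt).partialDeriv_eq]
  rfl

theorem _root_.ContDiffAt.partialDeriv {m n : ℕ∞ω} {i : Fin (d + 1)} {f : Ambient d → ℝ}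
    {y : Ambient d} (hf : ContDiffAt ℝ n f y) (hmn : m + 1 ≤ n) :
    ContDiffAt ℝ m (partialDeriv i f) y :=
  (hf.fderiv_right hmn).clm_apply contDiffAt_const

theorem laplacian_eq_sum_partialDeriv {f : Ambient d → ℝ} {y : Ambient d}
    (hf : ContDiffAt ℝ 2 f y) :
    (Δ f) y = ∑ i, partialDeriv i (partialDeriv i f) y := by
  rw [InnerProductSpace.laplacian_eq_iteratedFDeriv_orthonormalBasis f
    (EuclideanSpace.basisFun (Fin (d + 1)) ℝ)]
  refine Finset.sum_congr rfl fun i _ => ?_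
  have h1 : DifferentiableAt ℝ (fderiv ℝ f) y :=
    (hf.fderiv_right (m := 1) (by norm_num)).differentiableAt (by norm_num)
  have h2 : HasFDerivAt (partialDeriv i f) _ y :=
    h1.hasFDerivAt.clm_apply (hasFDerivAt_const (EuclideanSpace.single i (1 : ℝ)) y)
  rw [h2.partialDeriv_eq, iteratedFDeriv_two_apply]
  simp

/-- The Leibniz rule for the Laplacian. -/
theorem laplacian_mul {f g : Ambient d → ℝ} {y : Ambient d}
    (hf : ContDiffAt ℝ 2 f y) (hg : ContDiffAt ℝ 2 g y) :
    (Δ (fun z => f z * g z)) y = f y * (Δ g) y + g y * (Δ f) y +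
      2 * ∑ i, partialDeriv i f y * partialDeriv i g y := by
  rw [laplacian_eq_sum_partialDeriv hf, laplacian_eq_sum_partialDeriv hg,
    laplacian_eq_sum_partialDeriv (hf.mul hg), Finset.mul_sum, Finset.mul_sum, Finset.mul_sum,
    ← Finset.sum_add_distrib, ← Finset.sum_add_distrib]
  refine Finset.sum_congr rfl fun i _ => ?_
  have h1 : partialDeriv i (fun z => f z * g z) =ᶠ[𝓝 y]
      fun z => f z * partialDeriv i g z + g z * partialDeriv i f z := by
    filter_upwards [hf.eventually (by simp), hg.eventually (by simp)] with z hz1 hz2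
    exact partialDeriv_mul (hz1.differentiableAt (by norm_num)) (hz2.differentiableAt (by norm_num))
  have e : (1 : ℕ∞ω) + 1 ≤ 2 := by norm_num
  have df := hf.differentiableAt (n := 2) (by norm_num)
  have dg := hg.differentiableAt (n := 2) (by norm_num)
  have df' := (hf.partialDeriv (i := i) e).differentiableAt (by norm_num)
  have dg' := (hg.partialDeriv (i := i) e).differentiableAt (by norm_num)
  rw [partialDeriv_congr h1, partialDeriv_add (df.fun_mul dg') (dg.fun_mul df'),
    partialDeriv_mul df dg', partialDeriv_mul dg df']
  ring

/-! ### Radial functions -/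

theorem sum_sq_eq_normSq (y : Ambient d) : ∑ i, y i ^ 2 = ‖y‖ ^ 2 := by
  rw [EuclideanSpace.norm_sq_eq]
  simp

theorem contDiff_normSq : ContDiff ℝ ∞ fun y : Ambient d => ‖y‖ ^ 2 := contDiff_norm_sq ℝ

theorem partialDeriv_comp_normSq {i : Fin (d + 1)} {g : ℝ → ℝ} {g' : ℝ} {y : Ambient d}
    (hg : HasDerivAt g g' (‖y‖ ^ 2)) :
    partialDeriv i (fun z => g (‖z‖ ^ 2)) y = 2 * g' * y i := by
  have h := hg.comp_hasFDerivAt y (hasStrictFDerivAt_norm_sq y).hasFDerivAt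
  have h2 := h.partialDeriv_eq (i := i)
  simp only [Function.comp_def] at h2
  rw [h2]
  simp [EuclideanSpace.inner_single_right]
  ring

theorem partialDeriv_normSq_rpow {i : Fin (d + 1)} (s : ℝ) {y : Ambient d} (hy : y ≠ 0) :
    partialDeriv i (fun z => (‖z‖ ^ 2) ^ s) y = 2 * s * (‖y‖ ^ 2) ^ (s - 1) * y i := by
  rw [partialDeriv_comp_normSq (Real.hasDerivAt_rpow_const (p := s) (x := ‖y‖ ^ 2)
    (Or.inl (by positivity)))]
  ring

theorem hasFDerivAt_coord (i : Fin (d + 1)) (y : Ambient d) :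
    HasFDerivAt (fun z : Ambient d => z i) (EuclideanSpace.proj i : Ambient d →L[ℝ] ℝ) y :=
  (EuclideanSpace.proj i : Ambient d →L[ℝ] ℝ).hasFDerivAt

theorem contDiffAt_normSq_rpow (s : ℝ) {y : Ambient d} (hy : y ≠ 0) :
    ContDiffAt ℝ ∞ (fun z : Ambient d => (‖z‖ ^ 2) ^ s) y :=
  contDiff_normSq.contDiffAt.rpow_const_of_ne (by positivity)

theorem laplacian_normSq_rpow (s : ℝ) {y : Ambient d} (hy : y ≠ 0) :
    (Δ (fun z : Ambient d => (‖z‖ ^ 2) ^ s)) y =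
      2 * s * (d + 1 + 2 * (s - 1)) * (‖y‖ ^ 2) ^ (s - 1) := by
  rw [laplacian_eq_sum_partialDeriv ((contDiffAt_normSq_rpow s hy).of_le two_le_smooth)]
  have h : ∀ i, partialDeriv i (partialDeriv i (fun z : Ambient d => (‖z‖ ^ 2) ^ s)) y =
      2 * s * (‖y‖ ^ 2) ^ (s - 1) + 4 * s * (s - 1) * (‖y‖ ^ 2) ^ (s - 1 - 1) * y i ^ 2 := by
    intro i
    have h1 : partialDeriv i (fun z : Ambient d => (‖z‖ ^ 2) ^ s) =ᶠ[𝓝 y]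
        fun z => (2 * s * z i) * (‖z‖ ^ 2) ^ (s - 1) := by
      filter_upwards [isOpen_ne.mem_nhds hy] with z hz
      rw [partialDeriv_normSq_rpow s hz]
      ring
    have h2 := (hasFDerivAt_coord i y).const_mul (2 * s)
    rw [partialDeriv_congr h1, partialDeriv_mul h2.differentiableAt
      ((contDiffAt_normSq_rpow (s - 1) hy).differentiableAt (by simp)),
      partialDeriv_normSq_rpow _ hy, h2.partialDeriv_eq]
    simp
    ring
  simp_rw [h]
  rw [Finset.sum_add_distrib, ← Finset.mul_sum Finset.univ (fun i => y i ^ 2), sum_sq_eq_normSq]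
  have : (‖y‖ ^ 2) ^ (s - 1) = (‖y‖ ^ 2) ^ (s - 1 - 1) * ‖y‖ ^ 2 := by
    rw [← Real.rpow_add_one (by positivity)]
    ring_nf
  rw [this]
  simp
  ring

/-! ### Functions that are homogeneous of degree zero -/

/-- `f` is constant along the open rays from the origin. -/
def IsRadiallyConst (f : Ambient d → ℝ) : Prop :=
  ∀ y, y ≠ 0 → ∀ t : ℝ, 0 < t → f (t • y) = f y

theorem isRadiallyConst_homExtension (u : Sphere d → ℝ) : IsRadiallyConst (homExtension u) := by
  intro y hy t ht
  have hty : t • y ≠ 0 := smul_ne_zero ht.ne' hy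
  rw [homExtension, homExtension, dif_pos hy, dif_pos hty]
  congr 2
  rw [norm_smul, smul_smul, Real.norm_of_nonneg ht.le, mul_inv, mul_right_comm,
    inv_mul_cancel₀ ht.ne', one_mul]

/-- Euler's identity in degree zero. -/
theorem IsRadiallyConst.sum_mul_partialDeriv {f : Ambient d → ℝ} (hf : IsRadiallyConst f)
    {y : Ambient d} (hy : y ≠ 0) (hd : DifferentiableAt ℝ f y) :
    ∑ i, y i * partialDeriv i f y = 0 := by
  have h1 : ∑ i, y i * partialDeriv i f y = fderiv ℝ f y y := by
    have h := congrArg (fderiv ℝ f y) ((EuclideanSpace.basisFun (Fin (d + 1)) ℝ).sum_repr y)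
    rw [← h]
    simp only [map_sum, map_smul, smul_eq_mul, partialDeriv, EuclideanSpace.basisFun_repr,
      EuclideanSpace.basisFun_apply]
  have h2 : HasDerivAt (fun t : ℝ => t • y) y 1 := by
    simpa using (hasDerivAt_id (1 : ℝ)).smul_const y
  have h3 : HasDerivAt (fun t : ℝ => f (t • y)) (fderiv ℝ f y y) 1 := by
    have hd' : HasFDerivAt f (fderiv ℝ f y) ((1 : ℝ) • y) := by simpa using hd.hasFDerivAt
    exact hd'.comp_hasDerivAt 1 h2
  have h4 : (fun t : ℝ => f (t • y)) =ᶠ[𝓝 1] fun _ => f y := by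
    filter_upwards [lt_mem_nhds (zero_lt_one' ℝ)] with t ht using hf y hy t ht
  rw [h1, h3.unique ((hasDerivAt_const (1 : ℝ) (f y)).congr_of_eventuallyEq h4)]

theorem partialDeriv_comp_smul {i : Fin (d + 1)} {f : Ambient d → ℝ} (t : ℝ) (y : Ambient d)
    (hf : DifferentiableAt ℝ f (t • y)) :
    partialDeriv i (fun z => f (t • z)) y = t * partialDeriv i f (t • y) := by
  have h := hf.hasFDerivAt.comp y ((hasFDerivAt_id y).const_smul t)
  have h2 := h.partialDeriv_eq (i := i)
  simp only [Function.comp_def] at h2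
  rw [h2]
  simp [partialDeriv]

/-- The Laplacian of a function that is homogeneous of degree `0` is homogeneous of
degree `-2`. -/
theorem IsRadiallyConst.laplacian_smul {f : Ambient d → ℝ} (hf : IsRadiallyConst f)
    (hs : ∀ y, y ≠ 0 → ContDiffAt ℝ 2 f y) {y : Ambient d} (hy : y ≠ 0) {t : ℝ} (ht : 0 < t) :
    t ^ 2 * (Δ f) (t • y) = (Δ f) y := by
  have hne : ∀ {z : Ambient d}, z ≠ 0 → t • z ≠ 0 := fun hz => smul_ne_zero ht.ne' hz
  rw [laplacian_eq_sum_partialDeriv (hs y hy), laplacian_eq_sum_partialDeriv (hs _ (hne hy)),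
    Finset.mul_sum]
  refine Finset.sum_congr rfl fun i _ => ?_
  have h1 : ∀ z, z ≠ 0 → partialDeriv i f z = t * partialDeriv i f (t • z) := by
    intro z hz
    rw [← partialDeriv_comp_smul t z ((hs _ (hne hz)).differentiableAt (by norm_num))]
    refine partialDeriv_congr ?_
    filter_upwards [isOpen_ne.mem_nhds hz] with x hx using (hf x hx t ht).symm
  have h2 : partialDeriv i f =ᶠ[𝓝 y] fun z => t * partialDeriv i f (t • z) := by
    filter_upwards [isOpen_ne.mem_nhds hy] with z hz using h1 z hz
  have h3 : DifferentiableAt ℝ (partialDeriv i f) (t • y) :=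
    ((hs _ (hne hy)).partialDeriv (m := 1) (by norm_num)).differentiableAt (by norm_num)
  have h4 : DifferentiableAt ℝ (fun z : Ambient d => partialDeriv i f (t • z)) y :=
    DifferentiableAt.comp (g := partialDeriv i f) y h3 (differentiableAt_id.const_smul t)
  rw [partialDeriv_congr h2, partialDeriv_mul (differentiableAt_const t) h4,
    partialDeriv_comp_smul t y h3]
  simp [partialDeriv]
  ring

/-! ### A weighted inner product on the functions of the sphere -/

theorem coe_sphere_ne_zero (x : Sphere d) : (x : Ambient d) ≠ 0 :=
  ne_zero_of_mem_unit_sphere x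

theorem homExtension_coe (u : Sphere d → ℝ) (x : Sphere d) :
    homExtension u (x : Ambient d) = u x := by
  rw [homExtension, dif_pos (coe_sphere_ne_zero x)]
  congr 1
  ext1
  simp

theorem contDiffAt_homExtension_of_ne (u : SmoothFun d) {y : Ambient d} (hy : y ≠ 0) :
    ContDiffAt ℝ ∞ (homExtension u) y := by
  have ht : 0 < ‖y‖⁻¹ := by positivity
  have h1 : ContDiffAt ℝ ∞ (homExtension u) (‖y‖⁻¹ • y) :=
    contDiffAt_homExtension u ⟨‖y‖⁻¹ • y, normalize_mem hy⟩
  have h2 : ContDiffAt ℝ ∞ (fun z => homExtension u (‖y‖⁻¹ • z)) y :=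
    ContDiffAt.comp (g := homExtension u) y h1 (contDiffAt_id.const_smul _)
  refine h2.congr_of_eventuallyEq ?_
  filter_upwards [isOpen_ne.mem_nhds hy] with z hz
  exact (isRadiallyConst_homExtension u z hz _ ht).symm

/-- A smooth bump around `1` on the real line, to be composed with `y ↦ |y|²`. -/
def radialBump : ContDiffBump (1 : ℝ) := ⟨1 / 4, 1 / 2, by norm_num, by norm_num⟩

/-- A nonnegative smooth radial weight that is supported in a spherical shell around the unit
sphere. -/
def shellWeight (y : Ambient d) : ℝ := radialBump (‖y‖ ^ 2)

theorem shellWeight_nonneg (y : Ambient d) : 0 ≤ shellWeight y := radialBump.nonneg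

theorem contDiff_shellWeight : ContDiff ℝ ∞ (shellWeight : Ambient d → ℝ) :=
  radialBump.contDiff.comp contDiff_normSq

theorem shellWeight_coe (x : Sphere d) : shellWeight (x : Ambient d) = 1 := by
  have h : ‖(x : Ambient d)‖ = 1 := by simp
  rw [shellWeight, h, one_pow]
  exact radialBump.one_of_mem_closedBall (by simp [radialBump.rIn_pos.le])

theorem shellWeight_eq_zero {y : Ambient d} (hy : 1 / 2 ≤ |‖y‖ ^ 2 - 1|) : shellWeight y = 0 :=
  radialBump.zero_of_le_dist hy

theorem shellWeight_eventuallyEq_zero : (shellWeight : Ambient d → ℝ) =ᶠ[𝓝 0] fun _ => 0 := by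
  have h : ∀ᶠ y : Ambient d in 𝓝 0, ‖y‖ ^ 2 < 1 / 2 :=
    (contDiff_normSq.continuous.tendsto (0 : Ambient d)).eventually_lt_const (by simp)
  filter_upwards [h] with y hy
  refine shellWeight_eq_zero ?_
  rw [abs_of_neg (by linarith)]
  linarith

theorem hasCompactSupport_shellWeight : HasCompactSupport (shellWeight : Ambient d → ℝ) := by
  refine HasCompactSupport.intro (isCompact_closedBall (0 : Ambient d) 2) fun y hy => ?_
  refine shellWeight_eq_zero ?_
  have h : 2 < ‖y‖ := by simpa using hy
  rw [abs_of_pos (by nlinarith)]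
  nlinarith

/-- The weight removes the singularity that a homogeneous extension has at the origin. -/
theorem contDiff_shellWeight_mul {n : ℕ∞ω} (hn : n ≤ ∞) {f : Ambient d → ℝ}
    (hf : ∀ y, y ≠ 0 → ContDiffAt ℝ n f y) : ContDiff ℝ n fun y => shellWeight y * f y := by
  rw [contDiff_iff_contDiffAt]
  intro y
  by_cases hy : y = 0
  · subst hy
    refine contDiffAt_const (c := (0 : ℝ)).congr_of_eventuallyEq ?_
    filter_upwards [shellWeight_eventuallyEq_zero (d := d)] with z hz
    rw [hz, zero_mul]
  · exact (contDiff_shellWeight.contDiffAt.of_le hn).mul (hf y hy)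

theorem integrable_shellWeight_mul {f : Ambient d → ℝ}
    (hf : ∀ y, y ≠ 0 → ContDiffAt ℝ 0 f y) : Integrable fun y => shellWeight y * f y :=
  (contDiff_shellWeight_mul (by simp) hf).continuous.integrable_of_hasCompactSupport
    hasCompactSupport_shellWeight.mul_right

theorem integral_partialDeriv_eq_zero {i : Fin (d + 1)} {f : Ambient d → ℝ} (hf : ContDiff ℝ 1 f)
    (hc : HasCompactSupport f) : ∫ y, partialDeriv i f y = 0 := by
  have h1 : Integrable (partialDeriv i f) := by
    refine Continuous.integrable_of_hasCompactSupport ?_ ?_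
    · exact (hf.continuous_fderiv (by norm_num)).clm_apply continuous_const
    · exact (hc.fderiv (𝕜 := ℝ)).comp_left
        (g := fun l : Ambient d →L[ℝ] ℝ => l (EuclideanSpace.single i 1)) rfl
  have := integral_mul_fderiv_eq_neg_fderiv_mul_of_integrable (μ := (volume : Measure (Ambient d)))
    (f := fun _ => (1 : ℝ)) (g := f) (v := EuclideanSpace.single i 1)
    (by simp) (by simp only [one_mul]; exact h1)
    (by simpa using hf.continuous.integrable_of_hasCompactSupport hc)
    (fun _ _ => differentiableAt_const _)
    (fun _ _ => hf.contDiffAt.differentiableAt (by norm_num))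
  simpa [partialDeriv] using this

/-- Green's second identity on the shell. No gradient of the cutoff appears, because it is radial
while the gradients of `f` and `g` are tangential; the factor `|y|²` compensates the homogeneity of
the Laplacians. -/
theorem integral_green {f g : Ambient d → ℝ} (hf : IsRadiallyConst f) (hg : IsRadiallyConst g)
    (hf2 : ∀ y, y ≠ 0 → ContDiffAt ℝ 2 f y) (hg2 : ∀ y, y ≠ 0 → ContDiffAt ℝ 2 g y) :
    ∫ y, shellWeight y * (‖y‖ ^ 2 * (f y * (Δ g) y - g y * (Δ f) y)) = 0 := by
  have hle : (1 : ℕ∞ω) + 1 ≤ 2 := by norm_num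
  let F : Fin (d + 1) → Ambient d → ℝ := fun i y =>
    ‖y‖ ^ 2 * (f y * partialDeriv i g y - g y * partialDeriv i f y)
  have hF : ∀ i y, y ≠ 0 → ContDiffAt ℝ 1 (F i) y := by
    intro i y hy
    refine (contDiff_normSq.contDiffAt.of_le (by simp)).mul ?_
    exact (((hf2 y hy).of_le (by norm_num)).mul ((hg2 y hy).partialDeriv hle)).sub
      (((hg2 y hy).of_le (by norm_num)).mul ((hf2 y hy).partialDeriv hle))
  have hG : ∀ i, ContDiff ℝ 1 fun y => shellWeight y * F i y := fun i =>
    contDiff_shellWeight_mul (by simp) (hF i)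
  have hint : ∀ i, ∫ y, partialDeriv i (fun y => shellWeight y * F i y) y = 0 := fun i =>
    integral_partialDeriv_eq_zero (hG i) hasCompactSupport_shellWeight.mul_right
  have hsum : ∀ y, ∑ i, partialDeriv i (fun y => shellWeight y * F i y) y =
      shellWeight y * (‖y‖ ^ 2 * (f y * (Δ g) y - g y * (Δ f) y)) := by
    intro y
    by_cases hy : y = 0
    · subst hy
      rw [shellWeight_eventuallyEq_zero.self_of_nhds, zero_mul]
      refine Finset.sum_eq_zero fun i _ => ?_
      have : (fun y => shellWeight y * F i y) =ᶠ[𝓝 0] fun _ => (0 : ℝ) := by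
        filter_upwards [shellWeight_eventuallyEq_zero (d := d)] with z hz
        rw [hz, zero_mul]
      rw [partialDeriv_congr this, partialDeriv]
      simp
    · have df := (hf2 y hy).differentiableAt (by norm_num)
      have dg := (hg2 y hy).differentiableAt (by norm_num)
      have hb : HasDerivAt (fun r : ℝ => r * radialBump r)
          (radialBump (‖y‖ ^ 2) + ‖y‖ ^ 2 * deriv radialBump (‖y‖ ^ 2)) (‖y‖ ^ 2) := by
        simpa using (hasDerivAt_id' (‖y‖ ^ 2)).fun_mul
          ((radialBump.contDiff (n := 1)).contDiffAt.differentiableAt (by norm_num)).hasDerivAt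
      have dr : DifferentiableAt ℝ (fun z : Ambient d => ‖z‖ ^ 2 * radialBump (‖z‖ ^ 2)) y :=
        ((contDiff_normSq.mul (contDiff_shellWeight (d := d))).contDiffAt (x := y)).differentiableAt
          (by simp)
      have key : ∀ i, partialDeriv i (fun y => shellWeight y * F i y) y =
          shellWeight y * (‖y‖ ^ 2 * (f y * partialDeriv i (partialDeriv i g) y -
            g y * partialDeriv i (partialDeriv i f) y)) +
          2 * (radialBump (‖y‖ ^ 2) + ‖y‖ ^ 2 * deriv radialBump (‖y‖ ^ 2)) *
            (f y * (y i * partialDeriv i g y) - g y * (y i * partialDeriv i f y)) := by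
        intro i
        have df' := ((hf2 y hy).partialDeriv (i := i) hle).differentiableAt (by norm_num)
        have dg' := ((hg2 y hy).partialDeriv (i := i) hle).differentiableAt (by norm_num)
        have e : (fun y => shellWeight y * F i y) = fun z => (‖z‖ ^ 2 * radialBump (‖z‖ ^ 2)) *
            (f z * partialDeriv i g z - g z * partialDeriv i f z) := by
          funext z
          simp only [shellWeight, F]
          ring
        rw [e, partialDeriv_mul dr ((df.fun_mul dg').fun_sub (dg.fun_mul df')),
          partialDeriv_sub (df.fun_mul dg') (dg.fun_mul df'), partialDeriv_mul df dg',
          partialDeriv_mul dg df', partialDeriv_comp_normSq hb, shellWeight]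
        ring
      simp_rw [key]
      rw [laplacian_eq_sum_partialDeriv (hf2 y hy), laplacian_eq_sum_partialDeriv (hg2 y hy),
        Finset.sum_add_distrib, ← Finset.mul_sum, ← Finset.mul_sum, ← Finset.mul_sum,
        Finset.sum_sub_distrib, Finset.sum_sub_distrib, ← Finset.mul_sum, ← Finset.mul_sum,
        ← Finset.mul_sum, ← Finset.mul_sum, hf.sum_mul_partialDeriv hy df,
        hg.sum_mul_partialDeriv hy dg]
      ring
  have hI : ∀ i, Integrable (partialDeriv i (fun y => shellWeight y * F i y)) := by
    intro i
    refine Continuous.integrable_of_hasCompactSupport ?_ ?_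
    · exact ((hG i).continuous_fderiv (by norm_num)).clm_apply continuous_const
    · exact ((hasCompactSupport_shellWeight.mul_right (f' := F i)).fderiv (𝕜 := ℝ)).comp_left
        (g := fun l : Ambient d →L[ℝ] ℝ => l (EuclideanSpace.single i 1)) rfl
  simp_rw [← hsum]
  rw [integral_finsetSum _ fun i _ => hI i]
  exact Finset.sum_eq_zero fun i _ => hint i

theorem homExtension_add (u v : SmoothFun d) (y : Ambient d) :
    homExtension (u + v : SmoothFun d) y = homExtension u y + homExtension v y := by
  by_cases hy : y ≠ 0 <;> simp [homExtension, hy]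

theorem homExtension_smul (c : ℝ) (u : SmoothFun d) (y : Ambient d) :
    homExtension (c • u : SmoothFun d) y = c * homExtension u y := by
  by_cases hy : y ≠ 0 <;> simp [homExtension, hy]

theorem integrable_shell (u v : SmoothFun d) :
    Integrable fun y => shellWeight y * (homExtension u y * homExtension v y) :=
  integrable_shellWeight_mul fun _ hy => ((contDiffAt_homExtension_of_ne u hy).of_le (by simp)).mul
    ((contDiffAt_homExtension_of_ne v hy).of_le (by simp))

/-- The inner product `∫ w(|y|) u(y/|y|) v(y/|y|) dy` on smooth functions on the sphere, where
`w(|y|)` is the shell weight. In polar coordinates this is a positive multiple of the `L²` inner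
product of the sphere. -/
def shellInner (d : ℕ) : SmoothFun d →ₗ[ℝ] SmoothFun d →ₗ[ℝ] ℝ :=
  LinearMap.mk₂ ℝ
    (fun u v => ∫ y : Ambient d, shellWeight y * (homExtension u y * homExtension v y))
    (fun u v w => by
      rw [← integral_add (integrable_shell u w) (integrable_shell v w)]
      congr 1 with y
      rw [homExtension_add]
      ring)
    (fun c u v => by
      rw [smul_eq_mul, ← integral_const_mul]
      congr 1 with y
      rw [homExtension_smul]
      ring)
    (fun u v w => by
      rw [← integral_add (integrable_shell u v) (integrable_shell u w)]
      congr 1 with y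
      rw [homExtension_add]
      ring)
    (fun c u v => by
      rw [smul_eq_mul, ← integral_const_mul]
      congr 1 with y
      rw [homExtension_smul]
      ring)

theorem shellInner_apply (u v : SmoothFun d) :
    shellInner d u v = ∫ y : Ambient d, shellWeight y * (homExtension u y * homExtension v y) :=
  rfl

theorem eq_zero_of_shellInner_self {u : SmoothFun d} (h : shellInner d u u = 0) : u = 0 := by
  have hc : Continuous fun y => shellWeight y * (homExtension u y * homExtension u y) :=
    (contDiff_shellWeight_mul (n := 0) (by simp) fun _ hy =>
      ((contDiffAt_homExtension_of_ne u hy).of_le (by simp)).mul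
        ((contDiffAt_homExtension_of_ne u hy).of_le (by simp))).continuous
  have h0 := (hc.ae_eq_iff_eq (μ := volume) continuous_zero).mp
    ((integral_eq_zero_iff_of_nonneg
      (fun y => mul_nonneg (shellWeight_nonneg y) (mul_self_nonneg _))
      (integrable_shell u u)).mp h)
  ext x
  have := congrFun h0 (x : Ambient d)
  simpa [shellWeight_coe, homExtension_coe] using this

theorem abs_shellInner_le (u v : SmoothFun d) {c : ℝ} (hv : ∀ x, |v x| ≤ c) :
    |shellInner d u v| ≤ c * ∫ y : Ambient d, shellWeight y * |homExtension u y| := by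
  have hI : Integrable fun y => shellWeight y * |homExtension u y| := by
    have h := (integrable_shellWeight_mul (f := homExtension u) fun _ hy =>
      (contDiffAt_homExtension_of_ne u hy).of_le (by simp)).abs
    refine h.congr (Eventually.of_forall fun y => ?_)
    simp only [abs_mul, abs_of_nonneg (shellWeight_nonneg y)]
  rw [shellInner_apply, ← integral_const_mul]
  refine abs_integral_le_integral_abs.trans ?_
  refine integral_mono (integrable_shell u v).abs (hI.const_mul c) fun y => ?_
  simp only [abs_mul, abs_of_nonneg (shellWeight_nonneg y)]
  by_cases hy : y = 0
  · simp [hy, shellWeight_eventuallyEq_zero.self_of_nhds]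
  · have : |homExtension v y| ≤ c := by
      rw [homExtension, dif_pos hy]
      exact hv _
    have h2 := mul_le_mul_of_nonneg_left this
      (mul_nonneg (shellWeight_nonneg y) (abs_nonneg (homExtension u y)))
    linarith

theorem normSq_mul_laplacian_homExtension {u : SmoothFun d} {μ : ℝ} (hu : u ∈ eigenspace d μ)
    {y : Ambient d} (hy : y ≠ 0) :
    ‖y‖ ^ 2 * (Δ (homExtension u)) y = -μ * homExtension u y := by
  have hn : 0 < ‖y‖ := norm_pos_iff.mpr hy
  have h1 := (isRadiallyConst_homExtension u).laplacian_smul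
    (fun z hz => (contDiffAt_homExtension_of_ne u hz).of_le two_le_smooth) hy (inv_pos.mpr hn)
  have h2 := hu ⟨‖y‖⁻¹ • y, normalize_mem hy⟩
  rw [sphereLaplacian] at h2
  rw [← h1, homExtension, dif_pos hy, neg_mul, ← h2]
  field_simp

/-- Eigenfunctions for different eigenvalues are orthogonal. -/
theorem shellInner_eq_zero_of_ne {u v : SmoothFun d} {μ ν : ℝ} (hu : u ∈ eigenspace d μ)
    (hv : v ∈ eigenspace d ν) (h : μ ≠ ν) : shellInner d u v = 0 := by
  have hg := integral_green (isRadiallyConst_homExtension u) (isRadiallyConst_homExtension v)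
    (fun z hz => (contDiffAt_homExtension_of_ne u hz).of_le two_le_smooth)
    (fun z hz => (contDiffAt_homExtension_of_ne v hz).of_le two_le_smooth)
  have e : ∀ y : Ambient d, shellWeight y * (‖y‖ ^ 2 * (homExtension u y * (Δ (homExtension v)) y -
      homExtension v y * (Δ (homExtension u)) y)) =
      (μ - ν) * (shellWeight y * (homExtension u y * homExtension v y)) := by
    intro y
    by_cases hy : y = 0
    · simp [hy, shellWeight_eventuallyEq_zero.self_of_nhds]
    · have h1 := normSq_mul_laplacian_homExtension hu hy
      have h2 := normSq_mul_laplacian_homExtension hv hy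
      linear_combination shellWeight y * homExtension u y * h2 -
        shellWeight y * homExtension v y * h1
  simp_rw [e] at hg
  rw [integral_const_mul, mul_eq_zero, sub_eq_zero] at hg
  exact hg.resolve_left h

/-! ### Homogeneous and harmonic polynomials -/

open MvPolynomial in
/-- The Laplacian of a polynomial in `d + 1` variables. -/
def polyLaplacian (d : ℕ) : MvPolynomial (Fin (d + 1)) ℝ →ₗ[ℝ] MvPolynomial (Fin (d + 1)) ℝ :=
  ∑ i, (pderiv i).toLinearMap ∘ₗ (pderiv i).toLinearMap

open MvPolynomial in
/-- The polynomial `|x|² = ∑ xᵢ²`. -/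
def normSqPoly (d : ℕ) : MvPolynomial (Fin (d + 1)) ℝ := ∑ i, X i ^ 2

open MvPolynomial in
theorem polyLaplacian_apply (p : MvPolynomial (Fin (d + 1)) ℝ) :
    polyLaplacian d p = ∑ i, pderiv i (pderiv i p) := by
  simp [polyLaplacian]

theorem polyLaplacian_isHomogeneous {p : MvPolynomial (Fin (d + 1)) ℝ} {k : ℕ}
    (hp : p.IsHomogeneous k) : (polyLaplacian d p).IsHomogeneous (k - 2) := by
  rw [polyLaplacian_apply]
  exact MvPolynomial.IsHomogeneous.sum _ _ _ fun i _ => hp.pderiv.pderiv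

theorem normSqPoly_isHomogeneous : (normSqPoly d).IsHomogeneous 2 :=
  MvPolynomial.IsHomogeneous.sum _ _ _ fun i _ => MvPolynomial.isHomogeneous_X_pow i 2

theorem normSqPoly_mul_isHomogeneous {p : MvPolynomial (Fin (d + 1)) ℝ} {k : ℕ}
    (hp : p.IsHomogeneous k) : (normSqPoly d * p).IsHomogeneous (k + 2) :=
  add_comm 2 k ▸ normSqPoly_isHomogeneous.mul hp

open MvPolynomial in
theorem pderiv_normSqPoly (i : Fin (d + 1)) : pderiv i (normSqPoly d) = 2 * X i := by
  rw [normSqPoly, map_sum, Finset.sum_eq_single i]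
  · rw [Derivation.leibniz_pow, pderiv_X_self]
    simp
  · intro j _ hj
    rw [Derivation.leibniz_pow, pderiv_X_of_ne hj]
    simp
  · simp

open MvPolynomial in
theorem polyLaplacian_normSqPoly_mul {q : MvPolynomial (Fin (d + 1)) ℝ} {k : ℕ}
    (hq : q.IsHomogeneous k) :
    polyLaplacian d (normSqPoly d * q) =
      (2 * (d + 1) + 4 * k : ℝ) • q + normSqPoly d * polyLaplacian d q := by
  have h : ∀ i, pderiv i (pderiv i (normSqPoly d * q)) =
      2 * q + 4 * (X i * pderiv i q) + normSqPoly d * pderiv i (pderiv i q) := by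
    intro i
    have h2 : pderiv i (2 : MvPolynomial (Fin (d + 1)) ℝ) = 0 := by
      have := pderiv_C (i := i) (a := (2 : ℝ))
      rwa [map_ofNat] at this
    rw [pderiv_mul, pderiv_normSqPoly, map_add, pderiv_mul, pderiv_mul, pderiv_mul,
      pderiv_normSqPoly, pderiv_X_self, h2]
    ring
  rw [polyLaplacian_apply, polyLaplacian_apply]
  simp_rw [h]
  rw [Finset.sum_add_distrib, Finset.sum_add_distrib, ← Finset.mul_sum, ← Finset.mul_sum,
    hq.sum_X_mul_pderiv, smul_eq_C_mul]
  simp only [Finset.sum_const, Finset.card_univ, Fintype.card_fin, nsmul_eq_mul, map_add, map_mul,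
    map_ofNat, map_one, map_natCast, Finset.mul_sum, Nat.cast_add, Nat.cast_one]
  ring

theorem polyLaplacian_eq_zero_of_lt_two {k : ℕ} (hk : k < 2) {p : MvPolynomial (Fin (d + 1)) ℝ}
    (hp : p.IsHomogeneous k) : polyLaplacian d p = 0 := by
  rw [polyLaplacian_apply]
  refine Finset.sum_eq_zero fun i _ => ?_
  have h1 : (MvPolynomial.pderiv i p).IsHomogeneous 0 := by
    have h1 := hp.pderiv (i := i)
    have : k - 1 = 0 := by omega
    rwa [this] at h1
  rw [← MvPolynomial.totalDegree_zero_iff_isHomogeneous,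
    MvPolynomial.totalDegree_eq_zero_iff_eq_C] at h1
  rw [h1, MvPolynomial.pderiv_C]

/-- The operator `c + |x|² Δ` is injective on homogeneous polynomials for `c > 0`: a polynomial in
its kernel is divisible by `|x|²`, and the quotient lies in the kernel of an operator of the same
kind, in degree lower by `2`. -/
theorem eq_zero_of_smul_add_normSqPoly_mul {k : ℕ} : ∀ {q : MvPolynomial (Fin (d + 1)) ℝ} {c : ℝ},
    q.IsHomogeneous k → 0 < c → c • q + normSqPoly d * polyLaplacian d q = 0 → q = 0 := by
  induction k using Nat.strong_induction_on with
  | _ k ih =>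
    intro q c hq hc h
    have hL := polyLaplacian_isHomogeneous hq
    have hLq : polyLaplacian d q = 0 := by
      rcases lt_or_ge k 2 with hk | hk
      · exact polyLaplacian_eq_zero_of_lt_two hk hq
      · have h1 : c • polyLaplacian d q +
            ((2 * (d + 1) + 4 * (k - 2 : ℕ) : ℝ) • polyLaplacian d q +
              normSqPoly d * polyLaplacian d (polyLaplacian d q)) = 0 := by
          rw [← polyLaplacian_normSqPoly_mul hL, ← map_smul, ← map_add, h, map_zero]
        rw [← add_assoc, ← add_smul] at h1
        exact ih (k - 2) (by omega) hL (by positivity) h1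
    rw [hLq, mul_zero, add_zero] at h
    exact (smul_eq_zero.mp h).resolve_left hc.ne'

open MvPolynomial in
theorem finrank_homogeneousSubmodule (d k : ℕ) :
    Module.finrank ℝ (homogeneousSubmodule (Fin (d + 1)) ℝ k) = (d + k).choose d := by
  have h : homogeneousSubmodule (Fin (d + 1)) ℝ k =
      restrictSupport ℝ {f : Fin (d + 1) →₀ ℕ | f.degree = k} :=
    homogeneousSubmodule_eq_finsupp_supported _ _ _
  rw [h, Module.finrank_eq_nat_card_basis (basisRestrictSupport ℝ _)]
  have h2 : {f : Fin (d + 1) →₀ ℕ | f.degree = k} =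
      ((Finset.univ : Finset (Fin (d + 1))).finsuppAntidiag k : Set (Fin (d + 1) →₀ ℕ)) := by
    ext f
    simp [Finsupp.degree_eq_sum]
  rw [h2, Nat.card_coe_set_eq, Set.ncard_coe_finset, Finset.card_finsuppAntidiag_nat_eq_choose]
  have h3 : (Finset.univ : Finset (Fin (d + 1))).card + k - 1 = d + k := by
    rw [Finset.card_univ, Fintype.card_fin]
    omega
  rw [h3, Nat.choose_symm_add]

instance finite_homogeneousSubmodule (d k : ℕ) :
    Module.Finite ℝ (MvPolynomial.homogeneousSubmodule (Fin (d + 1)) ℝ k) :=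
  Module.Finite.iff_fg.mpr (MvPolynomial.homogeneousSubmodule_fg _ _ _)

/-- The harmonic polynomials that are homogeneous of degree `k`. -/
def harmonicPoly (d k : ℕ) : Submodule ℝ (MvPolynomial (Fin (d + 1)) ℝ) :=
  MvPolynomial.homogeneousSubmodule (Fin (d + 1)) ℝ k ⊓ LinearMap.ker (polyLaplacian d)

theorem mem_harmonicPoly_of_lt_two {k : ℕ} (hk : k < 2) {p : MvPolynomial (Fin (d + 1)) ℝ}
    (hp : p.IsHomogeneous k) : p ∈ harmonicPoly d k :=
  ⟨hp, polyLaplacian_eq_zero_of_lt_two hk hp⟩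

instance finite_harmonicPoly (d k : ℕ) : Module.Finite ℝ (harmonicPoly d k) :=
  Submodule.finiteDimensional_inf_left _ _

/-- The Laplacian on homogeneous polynomials of degree `k`. -/
def homPolyLaplacian (d k : ℕ) : MvPolynomial.homogeneousSubmodule (Fin (d + 1)) ℝ k →ₗ[ℝ]
    MvPolynomial.homogeneousSubmodule (Fin (d + 1)) ℝ (k - 2) :=
  (polyLaplacian d).restrict fun _ hp => (MvPolynomial.mem_homogeneousSubmodule _ _).mpr
    (polyLaplacian_isHomogeneous ((MvPolynomial.mem_homogeneousSubmodule _ _).mp hp))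

/-- Multiplication of homogeneous polynomials by `|x|²`. -/
def homMulNormSq (d k : ℕ) : MvPolynomial.homogeneousSubmodule (Fin (d + 1)) ℝ k →ₗ[ℝ]
    MvPolynomial.homogeneousSubmodule (Fin (d + 1)) ℝ (k + 2) :=
  (LinearMap.mulLeft ℝ (normSqPoly d)).restrict fun _ hp =>
    (MvPolynomial.mem_homogeneousSubmodule _ _).mpr
      (normSqPoly_mul_isHomogeneous ((MvPolynomial.mem_homogeneousSubmodule _ _).mp hp))

/-- On homogeneous polynomials of degree `k` the composition `p ↦ Δ (|x|² p)` is injective, hence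
bijective since the space is finite-dimensional. -/
theorem surjective_homPolyLaplacian_comp (d k : ℕ) :
    Function.Surjective (homPolyLaplacian d (k + 2) ∘ₗ homMulNormSq d k) := by
  refine LinearMap.surjective_of_injective ((injective_iff_map_eq_zero _).mpr fun q hq => ?_)
  have h1 : polyLaplacian d (normSqPoly d * q) = 0 := congrArg Subtype.val hq
  rw [polyLaplacian_normSqPoly_mul q.2] at h1
  exact Subtype.ext (eq_zero_of_smul_add_normSqPoly_mul q.2 (by positivity) h1)

/-- The dimension of the space of spherical harmonics of degree `k`; the binomial coefficient
`(d + k - 2).choose d` vanishes for `k < 2`. -/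
theorem finrank_harmonicPoly_add (hd : 1 ≤ d) (k : ℕ) :
    Module.finrank ℝ (harmonicPoly d k) + (d + k - 2).choose d = (d + k).choose d := by
  rcases lt_or_ge k 2 with hk | hk
  · have h : harmonicPoly d k = MvPolynomial.homogeneousSubmodule (Fin (d + 1)) ℝ k :=
      le_antisymm inf_le_left fun p hp => mem_harmonicPoly_of_lt_two hk hp
    rw [h, finrank_homogeneousSubmodule, Nat.choose_eq_zero_of_lt (by omega : d + k - 2 < d),
      add_zero]
  obtain ⟨k, rfl⟩ := Nat.exists_eq_add_of_le' hk
  have hker : Module.finrank ℝ (harmonicPoly d (k + 2)) =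
      Module.finrank ℝ (LinearMap.ker (homPolyLaplacian d (k + 2))) := by
    have h : harmonicPoly d (k + 2) = (LinearMap.ker (homPolyLaplacian d (k + 2))).map
        (MvPolynomial.homogeneousSubmodule (Fin (d + 1)) ℝ (k + 2)).subtype := by
      ext p
      simp [harmonicPoly, homPolyLaplacian, LinearMap.restrict_apply, and_comm]
    rw [h, Submodule.finrank_map_subtype_eq]
  have hrn := LinearMap.finrank_range_add_finrank_ker (homPolyLaplacian d (k + 2))
  have hs : Function.Surjective (homPolyLaplacian d (k + 2)) :=
    Function.Surjective.of_comp (surjective_homPolyLaplacian_comp d k)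
  rw [finrank_homogeneousSubmodule, ← hker, LinearMap.range_eq_top.mpr hs, finrank_top,
    finrank_homogeneousSubmodule] at hrn
  have : d + (k + 2) - 2 = d + (k + 2 - 2) := by omega
  rw [this]
  omega

/-- A homogeneous polynomial is the sum of a harmonic one and a multiple of `|x|²`. -/
theorem exists_harmonicPoly_add (k : ℕ) {p : MvPolynomial (Fin (d + 1)) ℝ}
    (hp : p.IsHomogeneous (k + 2)) : ∃ h ∈ harmonicPoly d (k + 2),
      ∃ q : MvPolynomial (Fin (d + 1)) ℝ, q.IsHomogeneous k ∧ p = h + normSqPoly d * q := by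
  obtain ⟨⟨q, hq0⟩, hq⟩ := surjective_homPolyLaplacian_comp d k
    (homPolyLaplacian d (k + 2) ⟨p, hp⟩)
  have hq' : polyLaplacian d (normSqPoly d * q) = polyLaplacian d p := congrArg Subtype.val hq
  refine ⟨p - normSqPoly d * q, ⟨hp.sub (normSqPoly_mul_isHomogeneous hq0), ?_⟩, q, hq0, by ring⟩
  simp [hq']

/-! ### Spherical harmonics -/

/-- A coordinate function on the sphere. -/
def sphereCoord (i : Fin (d + 1)) : SmoothFun d :=
  have : Fact (Module.finrank ℝ (Ambient d) = d + 1) := ⟨by simp⟩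
  ⟨fun x => (x : Ambient d) i,
    (EuclideanSpace.proj i : Ambient d →L[ℝ] ℝ).contDiff.contMDiff.comp
      (contMDiff_coe_sphere (E := Ambient d) (n := d))⟩

/-- The restriction of polynomials to the sphere. -/
def sphereRestrict (d : ℕ) : MvPolynomial (Fin (d + 1)) ℝ →ₐ[ℝ] SmoothFun d :=
  MvPolynomial.aeval sphereCoord

theorem sphereRestrict_apply (p : MvPolynomial (Fin (d + 1)) ℝ) (x : Sphere d) :
    sphereRestrict d p x = MvPolynomial.eval (x : Ambient d) p := by
  induction p using MvPolynomial.induction_on with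
  | C a =>
    rw [MvPolynomial.algHom_C]
    simp
    rfl
  | add p q hp hq => rw [map_add, map_add, ← hp, ← hq]; rfl
  | mul_X p i hp =>
    rw [map_mul, map_mul, ← hp, MvPolynomial.eval_X, sphereRestrict, MvPolynomial.aeval_X]
    rfl

/-- Differentiating the polynomial function agrees with the formal derivative. -/
theorem hasFDerivAt_eval (p : MvPolynomial (Fin (d + 1)) ℝ) (y : Ambient d) :
    ∃ L : Ambient d →L[ℝ] ℝ, HasFDerivAt (fun z : Ambient d => MvPolynomial.eval z p) L y ∧
      ∀ i, L (EuclideanSpace.single i 1) = MvPolynomial.eval y (MvPolynomial.pderiv i p) := by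
  induction p using MvPolynomial.induction_on with
  | C a => exact ⟨0, by simpa using hasFDerivAt_const a y, by simp⟩
  | add p q hp hq =>
    obtain ⟨L, hL, h1⟩ := hp
    obtain ⟨M, hM, h2⟩ := hq
    exact ⟨L + M, by simpa using hL.fun_add hM, by simp [h1, h2]⟩
  | mul_X p j hp =>
    obtain ⟨L, hL, h1⟩ := hp
    refine ⟨_, by simpa using hL.fun_mul (hasFDerivAt_coord j y), fun i => ?_⟩
    rw [MvPolynomial.pderiv_mul]
    by_cases h : j = i
    · subst h
      simp [h1]
      ring
    · simp [h1, MvPolynomial.pderiv_X_of_ne h, h]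
      ring

theorem partialDeriv_eval (i : Fin (d + 1)) (p : MvPolynomial (Fin (d + 1)) ℝ) (y : Ambient d) :
    partialDeriv i (fun z : Ambient d => MvPolynomial.eval z p) y =
      MvPolynomial.eval y (MvPolynomial.pderiv i p) := by
  obtain ⟨L, hL, h⟩ := hasFDerivAt_eval p y
  rw [hL.partialDeriv_eq, h]

theorem contDiff_eval (p : MvPolynomial (Fin (d + 1)) ℝ) :
    ContDiff ℝ ∞ fun z : Ambient d => MvPolynomial.eval z p := by
  induction p using MvPolynomial.induction_on with
  | C a => simpa using contDiff_const
  | add p q hp hq => simpa using hp.add hq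
  | mul_X p j hp =>
    simpa using hp.mul (EuclideanSpace.proj j : Ambient d →L[ℝ] ℝ).contDiff

theorem laplacian_eval (p : MvPolynomial (Fin (d + 1)) ℝ) (y : Ambient d) :
    (Δ (fun z : Ambient d => MvPolynomial.eval z p)) y =
      MvPolynomial.eval y (polyLaplacian d p) := by
  rw [laplacian_eq_sum_partialDeriv ((contDiff_eval p).contDiffAt.of_le two_le_smooth),
    polyLaplacian_apply, map_sum]
  refine Finset.sum_congr rfl fun i _ => ?_
  rw [funext fun z => partialDeriv_eval i p z, partialDeriv_eval]

theorem eval_smul_of_isHomogeneous {p : MvPolynomial (Fin (d + 1)) ℝ} {k : ℕ}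
    (hp : p.IsHomogeneous k) (t : ℝ) (y : Ambient d) :
    MvPolynomial.eval (t • y : Ambient d) p = t ^ k * MvPolynomial.eval y p := by
  rw [MvPolynomial.eval_eq', MvPolynomial.eval_eq', Finset.mul_sum]
  refine Finset.sum_congr rfl fun m hm => ?_
  have h : ∑ i, m i = k := by
    rw [hp.degree_eq_sum_deg_support hm]
    exact (Finset.sum_subset (Finset.subset_univ _) (by simp)).symm
  simp only [PiLp.smul_apply, smul_eq_mul, mul_pow, Finset.prod_mul_distrib,
    Finset.prod_pow_eq_pow_sum, h]
  ring

theorem homExtension_sphereRestrict {p : MvPolynomial (Fin (d + 1)) ℝ} {k : ℕ}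
    (hp : p.IsHomogeneous k) {y : Ambient d} (hy : y ≠ 0) :
    homExtension (sphereRestrict d p) y =
      MvPolynomial.eval y p * (‖y‖ ^ 2) ^ (-(k : ℝ) / 2) := by
  have h : (‖y‖ ^ 2) ^ (-(k : ℝ) / 2) = ‖y‖⁻¹ ^ k := by
    rw [← Real.rpow_natCast ‖y‖ 2, ← Real.rpow_mul (norm_nonneg y), ← Real.rpow_natCast,
      Real.inv_rpow (norm_nonneg y), ← Real.rpow_neg (norm_nonneg y)]
    congr 1
    push_cast
    ring
  rw [homExtension, dif_pos hy, sphereRestrict_apply, eval_smul_of_isHomogeneous hp, h, mul_comm]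

/-- The `k`-th eigenvalue (without multiplicity) of the sphere. -/
def sphereEigenvalue (d k : ℕ) : ℝ := k * (k + d - 1)

/-- A harmonic homogeneous polynomial of degree `k` restricts to an eigenfunction. -/
theorem sphereRestrict_mem_eigenspace {p : MvPolynomial (Fin (d + 1)) ℝ} {k : ℕ}
    (hp : p ∈ harmonicPoly d k) : sphereRestrict d p ∈ eigenspace d (sphereEigenvalue d k) := by
  intro x
  have hx := coe_sphere_ne_zero x
  have hn : ‖(x : Ambient d)‖ = 1 := by simp
  obtain ⟨hp1, hp2⟩ := hp
  have hp1 : p.IsHomogeneous k := hp1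
  have h1 : homExtension (sphereRestrict d p) =ᶠ[𝓝 (x : Ambient d)]
      fun y => MvPolynomial.eval y p * (‖y‖ ^ 2) ^ (-(k : ℝ) / 2) := by
    filter_upwards [isOpen_ne.mem_nhds hx] with y hy using homExtension_sphereRestrict hp1 hy
  have h2 : ∑ i, partialDeriv i (fun z : Ambient d => MvPolynomial.eval z p) x *
      partialDeriv i (fun z : Ambient d => (‖z‖ ^ 2) ^ (-(k : ℝ) / 2)) x =
      -(k : ℝ) * (k * MvPolynomial.eval (x : Ambient d) p) := by
    have h3 := congrArg (MvPolynomial.eval (x : Ambient d)) hp1.sum_X_mul_pderiv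
    rw [map_sum, map_nsmul, nsmul_eq_mul] at h3
    rw [← h3, Finset.mul_sum]
    refine Finset.sum_congr rfl fun i _ => ?_
    rw [partialDeriv_eval, partialDeriv_normSq_rpow _ hx, hn]
    simp
    ring
  rw [sphereLaplacian, InnerProductSpace.laplacian_congr_nhds h1 |>.self_of_nhds,
    laplacian_mul ((contDiff_eval p).contDiffAt.of_le two_le_smooth)
      ((contDiffAt_normSq_rpow _ hx).of_le two_le_smooth), h2, laplacian_normSq_rpow _ hx,
    laplacian_eval, LinearMap.mem_ker.mp hp2, hn, sphereRestrict_apply, sphereEigenvalue]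
  simp
  ring

theorem eq_zero_of_sphereRestrict_eq_zero {p : MvPolynomial (Fin (d + 1)) ℝ} {k : ℕ}
    (hp : p.IsHomogeneous k) (h : sphereRestrict d p = 0) : p = 0 := by
  have h1 : ∀ y : Ambient d, y ≠ 0 → MvPolynomial.eval y p = 0 := by
    intro y hy
    have h1 := homExtension_sphereRestrict hp hy
    have h2 : (‖y‖ ^ 2) ^ (-(k : ℝ) / 2) ≠ 0 := by positivity
    have h3 : homExtension (0 : SmoothFun d) y = 0 := by simp [homExtension]
    rw [h, h3] at h1
    exact (mul_eq_zero.mp h1.symm).resolve_right h2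
  refine hp.eq_zero_of_forall_eval_eq_zero fun r => ?_
  by_cases hr : (WithLp.toLp 2 r : Ambient d) = 0
  · have e : (EuclideanSpace.single 0 1 : Ambient d) ≠ 0 := by simp
    have h2 := eval_smul_of_isHomogeneous hp 0 (EuclideanSpace.single 0 1 : Ambient d)
    rw [zero_smul, ← hr, h1 _ e, mul_zero] at h2
    exact h2
  · exact h1 _ hr

/-! ### Completeness of the spherical harmonics -/

theorem sphereRestrict_normSqPoly : sphereRestrict d (normSqPoly d) = 1 := by
  ext x
  rw [sphereRestrict_apply]
  simp [normSqPoly, sum_sq_eq_normSq]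

theorem shellInner_sphereRestrict_eq_zero_of_isHomogeneous {u : SmoothFun d}
    (hu : ∀ k, ∀ p ∈ harmonicPoly d k, shellInner d u (sphereRestrict d p) = 0) (k : ℕ) :
    ∀ p : MvPolynomial (Fin (d + 1)) ℝ, p.IsHomogeneous k →
      shellInner d u (sphereRestrict d p) = 0 := by
  induction k using Nat.strong_induction_on with
  | _ k ih =>
    intro p hp
    rcases lt_or_ge k 2 with hk | hk
    -- polynomials of degree at most one are harmonic
    · exact hu k p (mem_harmonicPoly_of_lt_two hk hp)
    · obtain ⟨k, rfl⟩ := Nat.exists_eq_add_of_le' hk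
      obtain ⟨h, hh, q, hq, rfl⟩ := exists_harmonicPoly_add k hp
      rw [map_add, map_mul, sphereRestrict_normSqPoly, one_mul, map_add, hu _ h hh,
        ih k (by omega) q hq, add_zero]

/-- A smooth function that is orthogonal to all spherical harmonics is orthogonal to all
polynomials, hence to itself by the Stone-Weierstrass theorem. -/
theorem eq_zero_of_shellInner_harmonicPoly {u : SmoothFun d}
    (hu : ∀ k, ∀ p ∈ harmonicPoly d k, shellInner d u (sphereRestrict d p) = 0) : u = 0 := by
  have hpoly : ∀ p, shellInner d u (sphereRestrict d p) = 0 := by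
    intro p
    rw [← MvPolynomial.sum_homogeneousComponent p, map_sum, map_sum]
    exact Finset.sum_eq_zero fun k _ => shellInner_sphereRestrict_eq_zero_of_isHomogeneous hu k _
      (MvPolynomial.homogeneousComponent_isHomogeneous k p)
  let toCont : SmoothFun d →ₐ[ℝ] C(Sphere d, ℝ) :=
    { toFun := fun v => ⟨v, v.contMDiff.continuous⟩
      map_one' := rfl
      map_mul' := fun _ _ => rfl
      map_zero' := rfl
      map_add' := fun _ _ => rfl
      commutes' := fun _ => rfl }
  let A : Subalgebra ℝ C(Sphere d, ℝ) := (toCont.comp (sphereRestrict d)).range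
  have hA : A.SeparatesPoints := by
    intro x y hxy
    have : ∃ i, (x : Ambient d) i ≠ (y : Ambient d) i := by
      by_contra! h
      exact hxy (Subtype.ext (PiLp.ext h))
    obtain ⟨i, hi⟩ := this
    refine ⟨_, ⟨_, ⟨MvPolynomial.X i, rfl⟩, rfl⟩, ?_⟩
    change sphereRestrict d (MvPolynomial.X i) x ≠ sphereRestrict d (MvPolynomial.X i) y
    simpa [sphereRestrict_apply] using hi
  set c := ∫ y : Ambient d, shellWeight y * |homExtension u y| with hc
  have hc0 : 0 ≤ c := integral_nonneg fun y => mul_nonneg (shellWeight_nonneg y) (abs_nonneg _)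
  refine eq_zero_of_shellInner_self (abs_eq_zero.mp (le_antisymm ?_ (abs_nonneg _)))
  refine le_of_forall_pos_le_add fun ε hε => ?_
  have hδ : 0 < ε / (c + 1) := by positivity
  obtain ⟨⟨g, p, hp⟩, hg⟩ := ContinuousMap.exists_mem_subalgebra_near_continuous_of_separatesPoints
    A hA u u.contMDiff.continuous _ hδ
  have hb : ∀ x, |(u - sphereRestrict d p : SmoothFun d) x| ≤ ε / (c + 1) := by
    intro x
    have h1 := (hg x).le
    rw [Real.norm_eq_abs, abs_sub_comm] at h1
    have h2 : g x = sphereRestrict d p x := by rw [← hp]; rfl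
    have h3 : |u x - g x| ≤ ε / (c + 1) := h1
    rwa [h2] at h3
  have h := abs_shellInner_le u _ hb
  rw [map_sub, hpoly, sub_zero] at h
  refine h.trans ?_
  rw [zero_add, div_mul_eq_mul_div, div_le_iff₀ (by positivity)]
  nlinarith

/-! ### The multiplicities of the eigenvalues -/

theorem sphereEigenvalue_strictMono (hd : 1 ≤ d) : StrictMono (sphereEigenvalue d) := by
  refine strictMono_nat_of_lt_succ fun k => ?_
  have : (1 : ℝ) ≤ d := by exact_mod_cast hd
  simp only [sphereEigenvalue, Nat.cast_add, Nat.cast_one]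
  nlinarith [Nat.cast_nonneg (α := ℝ) k]

theorem multiplicity_sphereEigenvalue (hd : 1 ≤ d) (k : ℕ) :
    multiplicity d (sphereEigenvalue d k) = Module.finrank ℝ (harmonicPoly d k) := by
  let E := eigenspace d (sphereEigenvalue d k)
  let f : harmonicPoly d k →ₗ[ℝ] E :=
    ((sphereRestrict d).toLinearMap.domRestrict (harmonicPoly d k)).codRestrict E
      fun p => sphereRestrict_mem_eigenspace p.2
  -- restriction to the sphere gives the lower bound for the dimension
  have hf : Function.Injective f := by
    refine (injective_iff_map_eq_zero _).mpr fun p hp => Subtype.ext ?_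
    exact eq_zero_of_sphereRestrict_eq_zero p.2.1 (congrArg Subtype.val hp)
  let g : E →ₗ[ℝ] Module.Dual ℝ (harmonicPoly d k) :=
    ((shellInner d).compl₂ (sphereRestrict d).toLinearMap).compl₁₂ E.subtype
      (harmonicPoly d k).subtype
  -- pairing with harmonic polynomials of degree `k` gives the upper bound: those of other degrees
  -- are orthogonal to `E` anyway
  have hg : Function.Injective g := by
    refine (injective_iff_map_eq_zero _).mpr fun u hu => Subtype.ext ?_
    refine eq_zero_of_shellInner_harmonicPoly fun j p hp => ?_
    by_cases hj : j = k
    · subst hj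
      exact LinearMap.congr_fun hu ⟨p, hp⟩
    · exact shellInner_eq_zero_of_ne u.2 (sphereRestrict_mem_eigenspace hp)
        ((sphereEigenvalue_strictMono hd).injective.ne (Ne.symm hj))
  have : Module.Finite ℝ E := Module.Finite.of_injective g hg
  have h1 := LinearMap.finrank_le_finrank_of_injective hf
  have h2 := LinearMap.finrank_le_finrank_of_injective hg
  rw [Subspace.dual_finrank_eq] at h2
  rw [multiplicity, ← Module.finrank_eq_rank ℝ E, le_antisymm h1 h2]
  simp

theorem multiplicity_eq_zero {μ : ℝ} (hμ : ∀ k, μ ≠ sphereEigenvalue d k) :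
    multiplicity d μ = 0 := by
  have h : eigenspace d μ = ⊥ := by
    rw [eq_bot_iff]
    intro u hu
    exact eq_zero_of_shellInner_harmonicPoly fun k p hp =>
      shellInner_eq_zero_of_ne hu (sphereRestrict_mem_eigenspace hp) (hμ k)
  rw [multiplicity, h]
  simp

/-! ### The Riesz mean in closed form -/

/-- The number `(2n + d) (n + 1) ⋯ (n + d - 1) / d!` of eigenvalues `k (k + d - 1)` with `k ≤ n`,
counted with multiplicity. -/
def eigenvalueCount (d n : ℕ) : ℝ :=
  (2 * n + d) * ((n + 1).ascFactorial (d - 1) : ℝ) / (d.factorial : ℝ)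

theorem choose_mul_factorial (e n : ℕ) :
    ((e + n).choose (e + 1) : ℝ) * (e + 1).factorial = n * ((n + 1).ascFactorial e : ℝ) := by
  cases n with
  | zero => simp
  | succ n =>
    have h1 := Nat.ascFactorial_eq_factorial_mul_choose n (e + 1)
    have h2 := Nat.succ_ascFactorial (n + 1) e
    have h3 := Nat.ascFactorial_succ (n := n + 1) (k := e)
    have h4 : e + (n + 1) = n + (e + 1) := by ring
    rw [h4]
    norm_cast
    rw [h2, ← h3, h1, mul_comm]

theorem ascFactorial_relation (e n : ℕ) :
    ((n : ℝ) + 1) * ((n + 2).ascFactorial e : ℝ) = (n + e + 1) * ((n + 1).ascFactorial e : ℝ) := by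
  have h := Nat.succ_ascFactorial (n + 1) e
  have h2 : ((n + 1 : ℕ) : ℝ) * ((n + 2).ascFactorial e : ℝ) =
      ((n + 1 + e : ℕ) : ℝ) * ((n + 1).ascFactorial e : ℝ) := by exact_mod_cast h
  push_cast at h2
  linarith

theorem finrank_harmonicPoly_zero (hd : 1 ≤ d) :
    (Module.finrank ℝ (harmonicPoly d 0) : ℝ) = eigenvalueCount d 0 := by
  have h := finrank_harmonicPoly_add hd 0
  rw [Nat.choose_eq_zero_of_lt (by omega : d + 0 - 2 < d)] at h
  have h1 : Module.finrank ℝ (harmonicPoly d 0) = 1 := by simpa using h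
  obtain ⟨e, rfl⟩ := Nat.exists_eq_add_of_le' hd
  have : (e.factorial : ℝ) ≠ 0 := by positivity
  rw [h1, eigenvalueCount, Nat.factorial_succ]
  simp only [zero_add, Nat.add_sub_cancel, Nat.one_ascFactorial]
  push_cast
  field_simp
  ring

theorem finrank_harmonicPoly_succ (hd : 1 ≤ d) (n : ℕ) :
    (Module.finrank ℝ (harmonicPoly d (n + 1)) : ℝ) =
      eigenvalueCount d (n + 1) - eigenvalueCount d n := by
  have h := finrank_harmonicPoly_add hd (n + 1)
  obtain ⟨e, rfl⟩ := Nat.exists_eq_add_of_le' hd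
  have e1 : e + 1 + (n + 1) - 2 = e + n := by omega
  have e2 : e + 1 + (n + 1) = e + (n + 2) := by omega
  rw [e1, e2] at h
  have h' : (Module.finrank ℝ (harmonicPoly (e + 1) (n + 1)) : ℝ) + ((e + n).choose (e + 1) : ℝ) =
      ((e + (n + 2)).choose (e + 1) : ℝ) := by exact_mod_cast h
  have h1 := choose_mul_factorial e n
  have h2 := choose_mul_factorial e (n + 2)
  have h3 := ascFactorial_relation e n
  have h4 := ascFactorial_relation e (n + 1)
  have hf : ((e + 1).factorial : ℝ) ≠ 0 := by positivity
  rw [eigenvalueCount, eigenvalueCount, ← sub_div, eq_div_iff hf]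
  simp only [Nat.add_sub_cancel]
  push_cast at *
  have e3 : n + 1 + 1 = n + 2 := rfl
  have e4 : n + 1 + 2 = n + 2 + 1 := rfl
  rw [e3]
  rw [e4] at h4
  linear_combination ((e + 1).factorial : ℝ) * h' - h1 + h2 + h4 - h3

/-- Truncated sums over the spectrum in closed form. No relation between `z` and `n` is needed,
since both sides are affine in `z`. -/
theorem sum_finrank_mul_sub (hd : 1 ≤ d) (z : ℝ) (n : ℕ) :
    ∑ k ∈ Finset.range (n + 1),
      (Module.finrank ℝ (harmonicPoly d k) : ℝ) * (z - sphereEigenvalue d k) =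
      eigenvalueCount d n * (z - d / (d + 2) * (n * (n + d))) := by
  induction n with
  | zero => simp [finrank_harmonicPoly_zero hd, sphereEigenvalue]
  | succ n ih =>
    rw [Finset.sum_range_succ, ih, finrank_harmonicPoly_succ hd]
    obtain ⟨e, rfl⟩ := Nat.exists_eq_add_of_le' hd
    have h := ascFactorial_relation e n
    have hf : ((e + 1).factorial : ℝ) ≠ 0 := by positivity
    have he : ((e + 1 : ℕ) : ℝ) + 2 ≠ 0 := by positivity
    have h2 : eigenvalueCount (e + 1) (n + 1) *
        (sphereEigenvalue (e + 1) (n + 1) - ((e + 1 : ℕ) : ℝ) / ((e + 1 : ℕ) + 2) *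
          ((n + 1 : ℕ) * ((n + 1 : ℕ) + (e + 1 : ℕ)))) =
        eigenvalueCount (e + 1) n * (sphereEigenvalue (e + 1) (n + 1) -
          ((e + 1 : ℕ) : ℝ) / ((e + 1 : ℕ) + 2) * (n * (n + (e + 1 : ℕ)))) := by
      simp only [eigenvalueCount, sphereEigenvalue, Nat.add_sub_cancel]
      field_simp
      push_cast at *
      linear_combination (2 * (n : ℝ) + 2 + e + 1) * (2 * n + e + 1) * h
    linear_combination -h2

/-- Only the distinct eigenvalues below `z` contribute to the sum over all real `μ`. -/
theorem rieszMean_eq_sum (hd : 1 ≤ d) {z : ℝ} {N : ℕ} (hz : z ≤ sphereEigenvalue d N) :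
    rieszMean d z = ∑ k ∈ Finset.range N, (Module.finrank ℝ (harmonicPoly d k) : ENNReal) *
      ENNReal.ofReal (z - sphereEigenvalue d k) := by
  have hinj := (sphereEigenvalue_strictMono hd).injective
  rw [rieszMean, tsum_eq_sum (s := (Finset.range N).image (sphereEigenvalue d)),
    Finset.sum_image fun _ _ _ _ h => hinj h]
  · refine Finset.sum_congr rfl fun k _ => ?_
    rw [multiplicity_sphereEigenvalue hd]
    simp
  · intro μ hμ
    by_cases h : ∃ k, μ = sphereEigenvalue d k
    · obtain ⟨k, rfl⟩ := h
      have hk : N ≤ k := by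
        by_contra! h
        exact hμ (Finset.mem_image_of_mem _ (Finset.mem_range.mpr h))
      have := (sphereEigenvalue_strictMono hd).monotone hk
      rw [ENNReal.ofReal_of_nonpos (by linarith), mul_zero]
    · push Not at h
      rw [multiplicity_eq_zero h]
      simp

theorem exists_le_sphereEigenvalue (hd : 1 ≤ d) (z : ℝ) : ∃ N, z ≤ sphereEigenvalue d N := by
  obtain ⟨N, hN⟩ := exists_nat_ge (max z 1)
  have h1 : (1 : ℝ) ≤ d := by exact_mod_cast hd
  have h2 := le_trans (le_max_right z 1) hN
  refine ⟨N, (le_max_left z 1).trans (hN.trans ?_)⟩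
  rw [sphereEigenvalue]
  nlinarith

theorem rieszMean_ne_top (hd : 1 ≤ d) (z : ℝ) : rieszMean d z ≠ ⊤ := by
  obtain ⟨N, hN⟩ := exists_le_sphereEigenvalue hd z
  rw [rieszMean_eq_sum hd hN]
  exact ENNReal.sum_ne_top.mpr fun k _ =>
    ENNReal.mul_ne_top (ENNReal.natCast_ne_top _) ENNReal.ofReal_ne_top

theorem rieszMean_toReal (hd : 1 ≤ d) {w z : ℝ} (hw : 0 ≤ w) (hz : w * (w + d - 1) = z) :
    (rieszMean d z).toReal = eigenvalueCount d ⌊w⌋₊ *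
      (z - d / (d + 2) * (⌊w⌋₊ * (⌊w⌋₊ + d))) := by
  have h1 : (1 : ℝ) ≤ d := by exact_mod_cast hd
  have h2 := Nat.floor_le hw
  have h3 := (Nat.lt_floor_add_one w).le
  have h4 : (0 : ℝ) ≤ ⌊w⌋₊ := Nat.cast_nonneg _
  have hN : z ≤ sphereEigenvalue d (⌊w⌋₊ + 1) := by
    rw [sphereEigenvalue, ← hz]
    push_cast
    exact mul_le_mul h3 (by linarith) (by linarith) (by linarith)
  have hn : sphereEigenvalue d ⌊w⌋₊ ≤ z := by
    rw [sphereEigenvalue, ← hz]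
    exact mul_le_mul h2 (by linarith) (by linarith) hw
  rw [rieszMean_eq_sum hd hN, ← sum_finrank_mul_sub hd, ENNReal.toReal_sum fun k _ =>
    ENNReal.mul_ne_top (ENNReal.natCast_ne_top _) ENNReal.ofReal_ne_top]
  refine Finset.sum_congr rfl fun k hk => ?_
  have hk' := (sphereEigenvalue_strictMono hd).monotone
    (Nat.lt_succ_iff.mp (Finset.mem_range.mp hk))
  rw [ENNReal.toReal_mul, ENNReal.toReal_natCast, ENNReal.toReal_ofReal (by linarith)]

/-- Legendre's duplication formula turns the product of the semiclassical constant and the surface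
area into a rational number. -/
theorem semiclassicalConst_mul_sphereArea (hd : 1 ≤ d) :
    semiclassicalConst 1 d * sphereArea d = 4 / ((d + 2) * d.factorial) := by
  have hd0 : (0 : ℝ) < d := by exact_mod_cast hd
  have hπ := Real.pi_pos
  have h1 : sphereArea d = (d + 1) * (√Real.pi ^ (d + 1) / Real.Gamma ((d + 1) / 2 + 1)) := by
    have hG : 0 < Real.Gamma (((d : ℝ) + 1) / 2 + 1) := Real.Gamma_pos_of_pos (by positivity)
    rw [sphereArea, Measure.toSphere_real_apply_univ, Measure.real, EuclideanSpace.volume_ball]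
    simp only [finrank_euclideanSpace, Fintype.card_fin, ENNReal.ofReal_one, one_pow, one_mul]
    rw [ENNReal.toReal_ofReal (by push_cast; positivity)]
    push_cast
    ring
  have hG1 : Real.Gamma (((d : ℝ) + 1) / 2 + 1) = (d + 1) / 2 * Real.Gamma ((d + 1) / 2) :=
    Real.Gamma_add_one (by positivity)
  have hG2 : Real.Gamma (1 + 1 + (d : ℝ) / 2) = (d / 2 + 1) * (d / 2 * Real.Gamma (d / 2)) := by
    rw [← Real.Gamma_add_one (by positivity), ← Real.Gamma_add_one (by positivity)]
    congr 1
    ring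
  have hG3 : Real.Gamma ((1 : ℝ) + 1) = 1 := by
    rw [Real.Gamma_add_one one_ne_zero, Real.Gamma_one, one_mul]
  have hdup := Real.Gamma_mul_Gamma_add_half ((d : ℝ) / 2)
  have hd2 : 2 * ((d : ℝ) / 2) = d := by ring
  have hd3 : (d : ℝ) / 2 + 1 / 2 = (d + 1) / 2 := by ring
  rw [hd2, hd3] at hdup
  have hfac : (d.factorial : ℝ) = d * Real.Gamma d := by
    rw [← Real.Gamma_nat_eq_factorial, Real.Gamma_add_one hd0.ne']
  have hpow : (4 * Real.pi) ^ (-(d : ℝ) / 2) * √Real.pi ^ (d + 1) * 2 ^ (d : ℝ) = √Real.pi := by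
    have e1 : (4 : ℝ) * Real.pi = (2 * √Real.pi) ^ (2 : ℝ) := by
      rw [Real.rpow_two, mul_pow, Real.sq_sqrt hπ.le]
      norm_num
    rw [e1, ← Real.rpow_mul (by positivity), pow_succ, ← Real.rpow_natCast √Real.pi d]
    have e2 : (2 : ℝ) * (-(d : ℝ) / 2) = -d := by ring
    have hs : 0 < √Real.pi := Real.sqrt_pos.mpr hπ
    rw [e2, Real.rpow_neg (by positivity), Real.mul_rpow (by positivity) (by positivity)]
    have h2 : (0 : ℝ) < 2 ^ (d : ℝ) := by positivity
    have h3 : 0 < √Real.pi ^ (d : ℝ) := by positivity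
    field_simp
  have hg1 : 0 < Real.Gamma ((d : ℝ) / 2) := Real.Gamma_pos_of_pos (by positivity)
  have hg2 : 0 < Real.Gamma (((d : ℝ) + 1) / 2) := Real.Gamma_pos_of_pos (by positivity)
  have hg3 : 0 < Real.Gamma (d : ℝ) := Real.Gamma_pos_of_pos hd0
  have h2d : (2 : ℝ) ^ (1 - (d : ℝ)) = 2 / 2 ^ (d : ℝ) := by
    rw [Real.rpow_sub two_pos, Real.rpow_one]
  have h2p : (0 : ℝ) < 2 ^ (d : ℝ) := by positivity
  have hs : 0 < √Real.pi := Real.sqrt_pos.mpr hπ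
  rw [h2d] at hdup
  rw [semiclassicalConst, h1, hG1, hG2, hG3, hfac]
  have hA : (4 * Real.pi) ^ (-(d : ℝ) / 2) * √Real.pi ^ (d + 1) = √Real.pi / 2 ^ (d : ℝ) := by
    rw [eq_div_iff h2p.ne', hpow]
  calc _ = 2 * ((4 * Real.pi) ^ (-(d : ℝ) / 2) * √Real.pi ^ (d + 1)) /
        ((d / 2 + 1) * (d / 2) * (Real.Gamma (d / 2) * Real.Gamma ((d + 1) / 2))) := by
        field_simp
    _ = _ := by
        rw [hA, hdup]
        field_simp
        ring

/-! ### Second-order expansions with bounded coefficients -/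

/-- The expansion `f = 1 + b ε + c ε² + o(ε²)` at `+∞`, in which the coefficients `b` and `c` may
vary but stay bounded. -/
structure HasExpansion (ε f b c : ℝ → ℝ) : Prop where
  first : b =O[atTop] fun _ => (1 : ℝ)
  second : c =O[atTop] fun _ => (1 : ℝ)
  remainder : (fun z => f z - (1 + b z * ε z + c z * ε z ^ 2)) =o[atTop] fun z => ε z ^ 2

theorem HasExpansion.mul {ε f b c f' b' c' : ℝ → ℝ} (hε : Tendsto ε atTop (𝓝 0))
    (h : HasExpansion ε f b c) (h' : HasExpansion ε f' b' c') :
    HasExpansion ε (fun z => f z * f' z) (fun z => b z + b' z)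
      (fun z => c z + c' z + b z * b' z) := by
  have hbb : (fun z => b z * b' z) =O[atTop] fun _ => (1 : ℝ) := by simpa using h.first.mul h'.first
  refine ⟨h.first.add h'.first, (h.second.add h'.second).add hbb, ?_⟩
  have hε1 : ε =o[atTop] fun _ => (1 : ℝ) := (Asymptotics.isLittleO_one_iff ℝ).mpr hε
  have hε2 : (fun z => ε z ^ 2) =O[atTop] fun _ => (1 : ℝ) := by
    simpa [sq] using hε1.isBigO.mul hε1.isBigO
  have one : (fun _ : ℝ => (1 : ℝ)) =O[atTop] fun _ : ℝ => (1 : ℝ) := Asymptotics.isBigO_refl _ _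
  have hP : (fun z => 1 + b z * ε z + c z * ε z ^ 2) =O[atTop] fun _ => (1 : ℝ) := by
    refine (one.add ?_).add ?_
    · simpa using h.first.mul hε1.isBigO
    · simpa using h.second.mul hε2
  have hP' : (fun z => 1 + b' z * ε z + c' z * ε z ^ 2) =O[atTop] fun _ => (1 : ℝ) := by
    refine (one.add ?_).add ?_
    · simpa using h'.first.mul hε1.isBigO
    · simpa using h'.second.mul hε2
  have hf' : f' =O[atTop] fun _ => (1 : ℝ) := by
    simpa using (h'.remainder.isBigO.trans hε2).add hP'
  have t1 := h.remainder.mul_isBigO hf'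
  have t2 := hP.mul_isLittleO h'.remainder
  have hcross : (fun z => b z * c' z + c z * b' z + c z * c' z * ε z) =O[atTop]
      fun _ => (1 : ℝ) := by
    refine (Asymptotics.IsBigO.add ?_ ?_).add ?_
    · simpa using h.first.mul h'.second
    · simpa using h.second.mul h'.first
    · simpa using (h.second.mul h'.second).mul hε1.isBigO
  have t3 : (fun z => (b z * c' z + c z * b' z + c z * c' z * ε z) * ε z * ε z ^ 2)
      =o[atTop] fun z => ε z ^ 2 := by
    simpa using (hcross.mul_isLittleO hε1).mul_isBigO
      (Asymptotics.isBigO_refl (fun z => ε z ^ 2) atTop)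
  simp only [mul_one, one_mul] at t1 t2
  refine ((t1.add t2).add t3).congr_left fun z => ?_
  ring

theorem HasExpansion.quadratic {ε b c : ℝ → ℝ} (hb : b =O[atTop] fun _ => (1 : ℝ))
    (hc : c =O[atTop] fun _ => (1 : ℝ)) :
    HasExpansion ε (fun z => 1 + b z * ε z + c z * ε z ^ 2) b c :=
  ⟨hb, hc, by simp⟩

theorem HasExpansion.linear {ε b : ℝ → ℝ} (hb : b =O[atTop] fun _ => (1 : ℝ)) :
    HasExpansion ε (fun z => 1 + b z * ε z) b fun _ => 0 := by
  simpa using HasExpansion.quadratic (ε := ε) hb (Asymptotics.isBigO_zero _ _)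

theorem HasExpansion.prod {ε : ℝ → ℝ} (hε : Tendsto ε atTop (𝓝 0)) {a : ℕ → ℝ → ℝ}
    (ha : ∀ j, a j =O[atTop] fun _ => (1 : ℝ)) (m : ℕ) :
    HasExpansion ε (fun z => ∏ j ∈ Finset.range m, (1 + a j z * ε z))
      (fun z => ∑ j ∈ Finset.range m, a j z)
      (fun z => ((∑ j ∈ Finset.range m, a j z) ^ 2 - ∑ j ∈ Finset.range m, a j z ^ 2) / 2) := by
  induction m with
  | zero => simpa using HasExpansion.linear (ε := ε) (Asymptotics.isBigO_zero _ _)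
  | succ m ih =>
    have h := ih.mul hε (HasExpansion.linear (ha m))
    simp only [Finset.prod_range_succ, Finset.sum_range_succ]
    convert h using 2
    ring

theorem HasExpansion.rpow {ε : ℝ → ℝ} (hε : Tendsto ε atTop (𝓝 0)) (t q : ℝ) :
    HasExpansion ε (fun z => (1 + t * ε z ^ 2) ^ q) (fun _ => 0) fun _ => q * t := by
  refine ⟨Asymptotics.isBigO_zero _ _, Asymptotics.isBigO_const_one _ _ _, ?_⟩
  have h1 : HasDerivAt (fun x : ℝ => x ^ q) q 1 := by
    simpa using Real.hasDerivAt_rpow_const (p := q) (x := 1) (Or.inl one_ne_zero)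
  have h2 := hasDerivAt_iff_isLittleO.mp h1
  have h3 : Tendsto (fun z => 1 + t * ε z ^ 2) atTop (𝓝 1) := by
    simpa using ((hε.pow 2).const_mul t).const_add 1
  have h4 := h2.comp_tendsto h3
  have h5 : ((fun x' : ℝ => x' - 1) ∘ fun z => 1 + t * ε z ^ 2) =O[atTop] fun z => ε z ^ 2 := by
    have : ((fun x' : ℝ => x' - 1) ∘ fun z => 1 + t * ε z ^ 2) = fun z => t * ε z ^ 2 := by
      funext z
      simp
    rw [this]
    exact (Asymptotics.isBigO_refl _ _).const_mul_left t
  refine (h4.trans_isBigO h5).congr_left fun z => ?_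
  simp
  ring

/-! ### The fluctuation function and the second coefficient -/

theorem abs_fluct_le (η : ℝ) : |fluct η| ≤ 1 / 2 := by
  have h1 := Int.floor_le η
  have h2 := Int.lt_floor_add_one η
  rw [fluct, abs_le]
  constructor <;> linarith

theorem fluct_sq_le (η : ℝ) : fluct η ^ 2 ≤ 1 / 4 := by
  have h := sq_le_sq' (neg_le_of_abs_le (abs_fluct_le η)) (le_of_abs_le (abs_fluct_le η))
  linarith

theorem fluct_sq_eq_iff {η : ℝ} (hη : 0 ≤ η) : fluct η ^ 2 = 1 / 4 ↔ ∃ n : ℕ, η = n := by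
  constructor
  · intro h
    have h1 := Int.floor_le η
    have h2 := Int.lt_floor_add_one η
    have h3 : (η - ⌊η⌋) * (η - ⌊η⌋ - 1) = 0 := by
      rw [fluct] at h
      linear_combination h
    have h4 : η - ⌊η⌋ = 0 := (mul_eq_zero.mp h3).resolve_right (by linarith)
    refine ⟨⌊η⌋₊, ?_⟩
    rw [natCast_floor_eq_intCast_floor hη]
    linarith
  · rintro ⟨n, rfl⟩
    norm_num [fluct]

theorem secondCoeff_nonneg (hd : 2 ≤ d) (η : ℝ) : 0 ≤ secondCoeff d η := by
  have h1 : (2 : ℝ) ≤ d := by exact_mod_cast hd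
  have h2 := fluct_sq_le η
  exact mul_nonneg (by positivity) (by linarith)

theorem secondCoeff_eq_zero_iff (hd : 2 ≤ d) {η : ℝ} (hη : 0 ≤ η) :
    secondCoeff d η = 0 ↔ d = 2 ∧ ∃ n : ℕ, η = n := by
  have h1 : (2 : ℝ) ≤ d := by exact_mod_cast hd
  have h2 := fluct_sq_le η
  have h3 : (d : ℝ) * (d + 2) / 12 ≠ 0 := by positivity
  rw [← fluct_sq_eq_iff hη, secondCoeff, mul_eq_zero, or_iff_right h3]
  constructor
  · intro h
    have h4 : (d : ℝ) = 2 := by linarith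
    exact ⟨by exact_mod_cast h4, by linarith⟩
  · rintro ⟨rfl, h⟩
    rw [h]
    norm_num

theorem secondCoeff_mem_Icc (d : ℕ) (η : ℝ) :
    secondCoeff d η ∈
      Icc ((d : ℝ) * (d + 2) * (d - 2) / 12) ((d : ℝ) * (d + 2) * (2 * d - 1) / 24) := by
  have h1 : (0 : ℝ) ≤ (d : ℝ) * (d + 2) := by positivity
  have h2 := mul_nonneg h1 (sub_nonneg.mpr (fluct_sq_le η))
  have h3 := mul_nonneg h1 (sq_nonneg (fluct η))
  rw [secondCoeff]
  constructor <;> nlinarith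

theorem secondCoeff_natCast (d n : ℕ) :
    secondCoeff d n = (d : ℝ) * (d + 2) * (d - 2) / 12 := by
  rw [secondCoeff, (fluct_sq_eq_iff (Nat.cast_nonneg n)).mpr ⟨n, rfl⟩]
  ring

theorem secondCoeff_natCast_add_half (d n : ℕ) :
    secondCoeff d (n + 1 / 2) = (d : ℝ) * (d + 2) * (2 * d - 1) / 24 := by
  have h : fluct ((n : ℝ) + 1 / 2) = 0 := by
    have : ⌊(n : ℝ) + 1 / 2⌋ = n := by
      rw [Int.floor_eq_iff]
      push_cast
      constructor <;> linarith
    rw [fluct, this]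
    push_cast
    ring
  rw [secondCoeff, h]
  ring

/-! ### The asymptotic expansion -/

theorem sum_shift (x : ℝ) (m : ℕ) :
    ∑ j ∈ Finset.range m, ((j : ℝ) + 1 - x) = m * (m + 1) / 2 - m * x := by
  induction m with
  | zero => simp
  | succ m ih =>
    rw [Finset.sum_range_succ, ih]
    push_cast
    ring

theorem sum_shift_sq (x : ℝ) (m : ℕ) :
    ∑ j ∈ Finset.range m, ((j : ℝ) + 1 - x) ^ 2 =
      m * (m + 1) * (2 * m + 1) / 6 - x * m * (m + 1) + m * x ^ 2 := by
  induction m with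
  | zero => simp
  | succ m ih =>
    rw [Finset.sum_range_succ, ih]
    push_cast
    ring

theorem ascFactorial_eq_prod (n m : ℕ) :
    ((n + 1).ascFactorial m : ℝ) = ∏ j ∈ Finset.range m, ((n : ℝ) + 1 + j) := by
  rw [Nat.ascFactorial_eq_prod_range]
  push_cast
  rfl

/-- With `W = w + (d - 1) / 2` and `ε = 1 / W`, the ratio is a product of factors of the form
`1 + O(ε)`. -/
theorem rieszRatio_eq (hd : 1 ≤ d) {w z : ℝ} (hw : 0 ≤ w) (hz : w * (w + d - 1) = z)
    (hz0 : 0 < z) :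
    rieszRatio d z = (1 + -fluct w * (w + (d - 1) / 2)⁻¹) *
      (∏ j ∈ Finset.range (d - 1), (1 + ((j : ℝ) + 1 - (d / 2 + fluct w)) *
        (w + (d - 1) / 2)⁻¹)) *
      (1 + d * fluct w * (w + (d - 1) / 2)⁻¹ + (-((d + 2) * (d - 1) ^ 2 / 8) -
        d * fluct w ^ 2 / 2 + d ^ 3 / 8) * (w + (d - 1) / 2)⁻¹ ^ 2) *
      (1 + -((d - 1) ^ 2 / 4) * (w + (d - 1) / 2)⁻¹ ^ 2) ^ (-((d : ℝ) / 2 + 1)) := by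
  have h1 : (1 : ℝ) ≤ d := by exact_mod_cast hd
  have hw0 : w ≠ 0 := by
    rintro rfl
    simp at hz
    exact hz0.ne hz
  have hwp : 0 < w := lt_of_le_of_ne hw hw0.symm
  set W := w + ((d : ℝ) - 1) / 2 with hW
  have hWp : 0 < W := by
    have : 0 ≤ ((d : ℝ) - 1) / 2 := by linarith
    linarith
  set ψ := fluct w with hψ
  have hn : (⌊w⌋₊ : ℝ) = W - ψ - d / 2 := by
    rw [hψ, hW, fluct, natCast_floor_eq_intCast_floor hw]
    ring
  have hzW : z = W ^ 2 * (1 + -((d - 1) ^ 2 / 4) * W⁻¹ ^ 2) := by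
    field_simp
    rw [← hz, hW]
    ring
  have hq : 0 < 1 + -(((d : ℝ) - 1) ^ 2 / 4) * W⁻¹ ^ 2 := by
    by_contra! h
    have := mul_nonpos_of_nonneg_of_nonpos (sq_nonneg W) h
    linarith
  have hpow : z ^ ((d : ℝ) / 2 + 1) = W ^ 2 * W ^ d *
      (1 + -((d - 1) ^ 2 / 4) * W⁻¹ ^ 2) ^ ((d : ℝ) / 2 + 1) := by
    rw [hzW, Real.mul_rpow (by positivity) hq.le, ← Real.rpow_natCast W 2,
      ← Real.rpow_mul hWp.le, ← Real.rpow_natCast W d, ← Real.rpow_add hWp]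
    congr 2
    push_cast
    ring
  have hprod : ((⌊w⌋₊ + 1).ascFactorial (d - 1) : ℝ) * W = W ^ d *
      ∏ j ∈ Finset.range (d - 1), (1 + ((j : ℝ) + 1 - (d / 2 + ψ)) * W⁻¹) := by
    have e : ∀ j ∈ Finset.range (d - 1), (⌊w⌋₊ : ℝ) + 1 + j =
        W * (1 + ((j : ℝ) + 1 - (d / 2 + ψ)) * W⁻¹) := by
      intro j _
      rw [hn]
      field_simp
      ring
    rw [ascFactorial_eq_prod, Finset.prod_congr rfl e, Finset.prod_mul_distrib,
      Finset.prod_const, Finset.card_range]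
    obtain ⟨e, rfl⟩ := Nat.exists_eq_add_of_le' hd
    simp only [Nat.add_sub_cancel]
    ring
  have hlast : z - d / (d + 2) * (⌊w⌋₊ * (⌊w⌋₊ + d)) = 2 / (d + 2) * W ^ 2 *
      (1 + d * ψ * W⁻¹ + (-((d + 2) * (d - 1) ^ 2 / 8) - d * ψ ^ 2 / 2 + d ^ 3 / 8) *
        W⁻¹ ^ 2) := by
    rw [hzW, hn]
    field_simp
    ring
  have hfirst : 2 * (⌊w⌋₊ : ℝ) + d = 2 * (W * (1 + -ψ * W⁻¹)) := by
    rw [hn]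
    field_simp
    ring
  have hqp := Real.rpow_pos_of_pos hq ((d : ℝ) / 2 + 1)
  have hfac : (d.factorial : ℝ) ≠ 0 := by positivity
  rw [rieszRatio, rieszMean_toReal hd hw hz, semiclassicalConst_mul_sphereArea hd, hpow,
    eigenvalueCount, hfirst, hlast, Real.rpow_neg hq.le]
  generalize (1 + -(((d : ℝ) - 1) ^ 2 / 4) * W⁻¹ ^ 2) ^ ((d : ℝ) / 2 + 1) = Q at *
  generalize (1 + d * ψ * W⁻¹ + (-(((d : ℝ) + 2) * (d - 1) ^ 2 / 8) - d * ψ ^ 2 / 2 + d ^ 3 / 8) *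
        W⁻¹ ^ 2) = T at *
  generalize ∏ j ∈ Finset.range (d - 1), (1 + ((j : ℝ) + 1 - (d / 2 + ψ)) * W⁻¹) = P at *
  generalize 1 + -ψ * W⁻¹ = S at *
  generalize ((⌊w⌋₊ + 1).ascFactorial (d - 1) : ℝ) = A at *
  field_simp
  linear_combination 4 * S * T * hprod

theorem tendsto_shift_atTop (hd : 1 ≤ d) {w : ℝ → ℝ}
    (hw : ∀ z : ℝ, 0 ≤ z → 0 ≤ w z ∧ w z * (w z + (d : ℝ) - 1) = z) :
    Tendsto (fun z => w z + ((d : ℝ) - 1) / 2) atTop atTop := by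
  have h1 : (1 : ℝ) ≤ d := by exact_mod_cast hd
  refine tendsto_atTop_mono' atTop ?_ Real.tendsto_sqrt_atTop
  filter_upwards [eventually_ge_atTop 0] with z hz
  obtain ⟨h2, h3⟩ := hw z hz
  refine Real.sqrt_le_iff.mpr ⟨by linarith, ?_⟩
  nlinarith [sq_nonneg ((d : ℝ) - 1)]

theorem isBigO_one_of_abs_le {f : ℝ → ℝ} {C : ℝ} (h : ∀ z, |f z| ≤ C) :
    f =O[atTop] fun _ => (1 : ℝ) :=
  Asymptotics.IsBigO.of_bound C (Eventually.of_forall fun z => by simpa using h z)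

theorem isBigO_fluct (w : ℝ → ℝ) : (fun z => fluct (w z)) =O[atTop] fun _ => (1 : ℝ) :=
  isBigO_one_of_abs_le fun z => abs_fluct_le (w z)

theorem isBigO_secondCoeff (d : ℕ) (w : ℝ → ℝ) :
    (fun z => secondCoeff d (w z)) =O[atTop] fun _ => (1 : ℝ) := by
  have h : (fun z => fluct (w z) ^ 2) =O[atTop] fun _ => (1 : ℝ) := by
    simpa [sq] using (isBigO_fluct w).mul (isBigO_fluct w)
  have h2 := ((Asymptotics.isBigO_const_one ℝ (1 / 4 : ℝ) atTop).sub h).const_mul_left 6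
  exact ((Asymptotics.isBigO_const_one ℝ ((d : ℝ) - 2) atTop).add h2).const_mul_left _

/-- The expansion in powers of `1 / W`, where `W = w + (d - 1) / 2`. The contributions of first
order, `-ψ` from the factor `2n + d`, `-(d - 1) ψ` from the rising factorial and `d ψ` from the
last factor, cancel. -/
theorem rieszRatio_isLittleO_shift (hd : 1 ≤ d) {w : ℝ → ℝ}
    (hw : ∀ z : ℝ, 0 ≤ z → 0 ≤ w z ∧ w z * (w z + (d : ℝ) - 1) = z) :
    (fun z => rieszRatio d z - (1 + secondCoeff d (w z) * (w z + ((d : ℝ) - 1) / 2)⁻¹ ^ 2))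
      =o[atTop] fun z => (w z + ((d : ℝ) - 1) / 2)⁻¹ ^ 2 := by
  have hε : Tendsto (fun z => (w z + ((d : ℝ) - 1) / 2)⁻¹) atTop (𝓝 0) :=
    tendsto_inv_atTop_zero.comp (tendsto_shift_atTop hd hw)
  have hψ := isBigO_fluct w
  have hψ2 : (fun z => fluct (w z) ^ 2) =O[atTop] fun _ => (1 : ℝ) := by
    simpa [sq] using hψ.mul hψ
  have e1 := HasExpansion.linear (ε := fun z => (w z + ((d : ℝ) - 1) / 2)⁻¹) hψ.neg_left
  have ha : ∀ j : ℕ, (fun z => (j : ℝ) + 1 - ((d : ℝ) / 2 + fluct (w z))) =O[atTop]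
      fun _ => (1 : ℝ) := fun j =>
    (Asymptotics.isBigO_const_one ℝ ((j : ℝ) + 1) atTop).sub
      ((Asymptotics.isBigO_const_one ℝ ((d : ℝ) / 2) atTop).add hψ)
  have e2 := HasExpansion.prod hε ha (d - 1)
  have e3 := HasExpansion.quadratic (ε := fun z => (w z + ((d : ℝ) - 1) / 2)⁻¹)
    (hψ.const_mul_left (d : ℝ))
    (((Asymptotics.isBigO_const_one ℝ (-(((d : ℝ) + 2) * (d - 1) ^ 2 / 8)) atTop).sub
      (hψ2.const_mul_left ((d : ℝ) / 2))).add
        (Asymptotics.isBigO_const_one ℝ ((d : ℝ) ^ 3 / 8) atTop))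
  have e4 := HasExpansion.rpow hε (-(((d : ℝ) - 1) ^ 2 / 4)) (-((d : ℝ) / 2 + 1))
  have H := (((e1.mul hε e2).mul hε e3).mul hε e4).remainder
  refine H.congr' ?_ (Eventually.of_forall fun _ => rfl)
  filter_upwards [eventually_gt_atTop 0] with z hz
  have hcast : ((d - 1 : ℕ) : ℝ) = d - 1 := by
    rw [Nat.cast_sub hd, Nat.cast_one]
  rw [rieszRatio_eq hd (hw z hz.le).1 (hw z hz.le).2 hz, sum_shift, sum_shift_sq, hcast,
    secondCoeff]
  ring

theorem rieszRatio_isLittleO (hd : 1 ≤ d) {w : ℝ → ℝ}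
    (hw : ∀ z : ℝ, 0 ≤ z → 0 ≤ w z ∧ w z * (w z + (d : ℝ) - 1) = z) :
    (fun z => rieszRatio d z - (1 + secondCoeff d (w z) * z⁻¹)) =o[atTop] fun z => z⁻¹ := by
  have hW := tendsto_shift_atTop hd hw
  -- `1 / W² - 1 / z = -(d - 1)² / (4 W² z)`
  have hdiff : (fun z => (w z + ((d : ℝ) - 1) / 2)⁻¹ ^ 2 - z⁻¹) =o[atTop] fun z : ℝ => z⁻¹ := by
    have h1 : (fun z => -(((d : ℝ) - 1) ^ 2 / 4) * (w z + ((d : ℝ) - 1) / 2)⁻¹ ^ 2) =o[atTop]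
        fun _ => (1 : ℝ) := by
      rw [Asymptotics.isLittleO_one_iff]
      simpa using ((tendsto_inv_atTop_zero.comp hW).pow 2).const_mul (-(((d : ℝ) - 1) ^ 2 / 4))
    have h2 := h1.mul_isBigO (Asymptotics.isBigO_refl (fun z : ℝ => z⁻¹) atTop)
    simp only [one_mul] at h2
    refine h2.congr' ?_ (Eventually.of_forall fun _ => rfl)
    filter_upwards [eventually_gt_atTop 0, hW.eventually_gt_atTop 0] with z hz hWz
    have h3 : (w z + ((d : ℝ) - 1) / 2) ^ 2 = z + (d - 1) ^ 2 / 4 := by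
      linear_combination (hw z hz.le).2
    have h4 : z + ((d : ℝ) - 1) ^ 2 / 4 ≠ 0 := by positivity
    rw [inv_pow, h3]
    field_simp
    ring
  have hO : (fun z => (w z + ((d : ℝ) - 1) / 2)⁻¹ ^ 2) =O[atTop] fun z : ℝ => z⁻¹ := by
    simpa using hdiff.isBigO.add (Asymptotics.isBigO_refl (fun z : ℝ => z⁻¹) atTop)
  have h1 := (rieszRatio_isLittleO_shift hd hw).trans_isBigO hO
  have h2 := (isBigO_secondCoeff d w).mul_isLittleO hdiff
  simp only [one_mul] at h2
  refine (h1.add h2).congr_left fun z => ?_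
  ring

theorem rieszRatio_sub_one_isLittleO (hd : 1 ≤ d) {w : ℝ → ℝ}
    (hw : ∀ z : ℝ, 0 ≤ z → 0 ≤ w z ∧ w z * (w z + (d : ℝ) - 1) = z) :
    (fun z => rieszRatio d z - 1) =o[atTop] fun z : ℝ => z ^ (-(1 / 2) : ℝ) := by
  have h1 : (fun z => secondCoeff d (w z) * z⁻¹) =O[atTop] fun z : ℝ => z⁻¹ := by
    simpa using (isBigO_secondCoeff d w).mul (Asymptotics.isBigO_refl (fun z : ℝ => z⁻¹) atTop)
  have h2 : (fun z => rieszRatio d z - 1) =O[atTop] fun z : ℝ => z⁻¹ :=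
    ((rieszRatio_isLittleO hd hw).isBigO.add h1).congr_left fun z => by ring
  refine h2.trans_isLittleO ?_
  have h3 : (fun z : ℝ => z ^ (-(1 / 2) : ℝ)) =o[atTop] fun _ => (1 : ℝ) :=
    (Asymptotics.isLittleO_one_iff ℝ).mpr (tendsto_rpow_neg_atTop (by norm_num))
  have h4 := h3.mul_isBigO
    (Asymptotics.isBigO_refl (fun z : ℝ => z ^ (-(1 / 2) : ℝ)) atTop)
  simp only [one_mul] at h4
  refine h4.congr' ?_ (Eventually.of_forall fun _ => rfl)
  filter_upwards [eventually_gt_atTop 0] with z hz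
  rw [← Real.rpow_add hz, ← Real.rpow_neg_one]
  norm_num

/-- A property that holds at every term of an unbounded sequence `η` holds at `w z` for arbitrarily
large `z`, since `w` takes the value `η n` at `z = η n (η n + d - 1)`. -/
theorem frequently_of_seq (hd : 1 ≤ d) {w : ℝ → ℝ}
    (hw : ∀ z : ℝ, 0 ≤ z → 0 ≤ w z ∧ w z * (w z + (d : ℝ) - 1) = z) {p : ℝ → Prop} {η : ℕ → ℝ}
    (hη : ∀ n : ℕ, (n : ℝ) ≤ η n) (hp : ∀ n, p (η n)) : ∃ᶠ z in atTop, p (w z) := by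
  have h1 : (1 : ℝ) ≤ d := by exact_mod_cast hd
  rw [frequently_atTop]
  intro a
  obtain ⟨n, hn⟩ := exists_nat_ge (max a 1)
  have hn1 : 1 ≤ η n := (le_max_right a 1).trans (hn.trans (hη n))
  have hna : a ≤ η n := (le_max_left a 1).trans (hn.trans (hη n))
  have hz : 0 ≤ η n * (η n + d - 1) := mul_nonneg (by linarith) (by linarith)
  refine ⟨η n * (η n + d - 1), by nlinarith, ?_⟩
  obtain ⟨h2, h3⟩ := hw _ hz
  have h4 : (w (η n * (η n + d - 1)) - η n) * (w (η n * (η n + d - 1)) + η n + d - 1) = 0 := by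
    linear_combination h3
  have h5 := (mul_eq_zero.mp h4).resolve_right (by linarith)
  rw [sub_eq_zero.mp h5]
  exact hp n

end RieszSphere

end

theorem mainTheorem1 (d : ℕ) (hd : 2 ≤ d) (w : ℝ → ℝ)
    (hw : ∀ z : ℝ, 0 ≤ z → 0 ≤ w z ∧ w z * (w z + (d : ℝ) - 1) = z) :
    -- the Riesz mean is finite
    (∀ z : ℝ, RieszSphere.rieszMean d z ≠ ⊤) ∧
    -- the asymptotic expansion
    ((fun z : ℝ => RieszSphere.rieszRatio d z -
        (1 + RieszSphere.secondCoeff d (w z) * z⁻¹)) =o[atTop] fun z : ℝ => z⁻¹) ∧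
    -- there is no term of order `z^{-1/2}`
    ((fun z : ℝ => RieszSphere.rieszRatio d z - 1) =o[atTop] fun z : ℝ => z ^ (-(1 / 2) : ℝ)) ∧
    -- sign of the coefficient of `z⁻¹`
    (∀ z : ℝ, 0 ≤ z → 0 ≤ RieszSphere.secondCoeff d (w z) ∧
      (RieszSphere.secondCoeff d (w z) = 0 ↔ d = 2 ∧ ∃ n : ℕ, w z = n)) ∧
    -- oscillation of the coefficient of `z⁻¹`
    (∀ z : ℝ, 0 ≤ z →
      RieszSphere.secondCoeff d (w z) ∈
        Icc ((d : ℝ) * (d + 2) * (d - 2) / 12) ((d : ℝ) * (d + 2) * (2 * d - 1) / 24)) ∧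
    (∃ᶠ z : ℝ in atTop,
      RieszSphere.secondCoeff d (w z) = (d : ℝ) * (d + 2) * (d - 2) / 12) ∧
    (∃ᶠ z : ℝ in atTop,
      RieszSphere.secondCoeff d (w z) = (d : ℝ) * (d + 2) * (2 * d - 1) / 24) := by
  have hd1 : 1 ≤ d := by omega
  exact ⟨RieszSphere.rieszMean_ne_top hd1, RieszSphere.rieszRatio_isLittleO hd1 hw,
    RieszSphere.rieszRatio_sub_one_isLittleO hd1 hw,
    fun z hz => ⟨RieszSphere.secondCoeff_nonneg hd _,
      RieszSphere.secondCoeff_eq_zero_iff hd (hw z hz).1⟩,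
    fun z _ => RieszSphere.secondCoeff_mem_Icc d _,
    RieszSphere.frequently_of_seq hd1 hw (η := fun n => n)
      (p := fun η => RieszSphere.secondCoeff d η = (d : ℝ) * (d + 2) * (d - 2) / 12)
      (fun _ => le_rfl) (RieszSphere.secondCoeff_natCast d),
    RieszSphere.frequently_of_seq hd1 hw (η := fun n => n + 1 / 2)
      (p := fun η => RieszSphere.secondCoeff d η = (d : ℝ) * (d + 2) * (2 * d - 1) / 24)
      (fun _ => by linarith) (RieszSphere.secondCoeff_natCast_add_half d)⟩
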